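/- Let $n\ge 0$ and $k\ge 2$ be integers and let $\omega$ be a primitive $k$-th root of unity. On $L^2(S^1,\mathbb C^n)$ let $(Sf)(\lambda)=\lambda f(\lambda)$ and $f_w(\lambda)=f(w\lambda)$ for $w\in S^1$, and let $\mathcal H_+$ be the Hardy space of all $f\in L^2(S^1,\mathbb C^n)$ whose Fourier coefficients of negative index vanish. A closed subspace $V$ of $L^2(S^1,\mathbb C^n)$ is called shift-invariant if $SV\subseteq V$. Let $W$ be a closed shift-invariant subspace which is $k$-symmetric, i.e. $f_\omega\in W$ for all $f\in W$. (i) For $0\le j\le k-1$ the subspace $$W_j=\{f\in W: f_\omega=\omega^j f\}=\Bigl\{g\in W: g(\lambda)=\sum_{l=0}^{k-1}\omega^{-lj}f(\omega^l\lambda)\text{ for some } f\in W\Bigr\}$$ is closed, and $W=\bigoplus_{j=0}^{k-1}W_j$ (an orthogonal direct sum). (ii) There exist closed shift-invariant subspaces $V_0,\dots,V_{k-1}$ of $L^2(S^1,\mathbb C^n)$ with $SV_{k-1}\subseteq V_0\subseteq V_1\subseteq\cdots\subseteq V_{k-1}$ and $$W_j=S^j\{g\in L^2(S^1,\mathbb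 C^n): g(\lambda)=f(\lambda^k)\text{ for some } f\in V_j\},\qquad 0\le j\le k-1.$$ (iii) Suppose $W=\Phi\mathcal H_+$ with $\Phi$ measurable and $\mathrm U(n)$-valued a.e. on $S^1$. Then, for the $V_j$ of (ii), $V_{k-1}=\Psi\mathcal H_+$ with $\Psi$ measurable and $\mathrm U(n)$-valued a.e. on $S^1$, and there are subspaces $\alpha_0\subseteq\alpha_1\subseteq\cdots\subseteq\alpha_{k-2}\subseteq\mathbb C^n$, with orthogonal projections $\pi_{\alpha_j}$ (and $\pi_{\alpha_j}^\perp=I-\pi_{\alpha_j}$), such that $$V_j=\Psi(\pi_{\alpha_j}+\lambda\pi_{\alpha_j}^\perp)\mathcal H_+=\Psi(\alpha_j+\lambda\mathcal H_+),\qquad 0\le j\le k-2,$$ and $$W=\Psi(\lambda^k)\bigl(\alpha_0+\lambda\alpha_1+\cdots+\lambda^{k-2}\alpha_{k-2}+\lambda^{k-1}\mathcal H_+\bigr).$$ -/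

import Mathlib

open MeasureTheory

noncomputable section

namespace SymShift

/-- The Borel σ-algebra on the unit circle `S¹ ⊆ ℂ`. -/
instance instMeasurableSpaceCircle : MeasurableSpace Circle := borel Circle

instance instBorelSpaceCircle : BorelSpace Circle := ⟨rfl⟩

/-- Normalized arc length on `S¹`, i.e. the Haar probability measure. -/
def arc : Measure Circle := Measure.haarMeasure ⊤

instance instIsHaarMeasureArc : arc.IsHaarMeasure := by
  unfold arc; infer_instance

instance instIsProbabilityMeasureArc : IsProbabilityMeasure arc :=
  ⟨by simpa [arc] using Measure.haarMeasure_self (G := Circle) (K₀ := ⊤)⟩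

/-- `ℂⁿ` with its Hermitian inner product. -/
abbrev Cn (n : ℕ) : Type := EuclideanSpace ℂ (Fin n)

/-- The Hilbert space `L²(S¹, ℂⁿ)`. -/
abbrev L2 (n : ℕ) : Type := Lp (Cn n) 2 arc

theorem continuous_coe_circle : Continuous fun z : Circle => (z : ℂ) :=
  continuous_subtype_val

theorem memLp_smul_coe {n : ℕ} (f : L2 n) :
    MemLp (fun z : Circle => (z : ℂ) • f z) 2 arc := by
  have hm : AEStronglyMeasurable (fun z : Circle => (z : ℂ) • f z) arc :=
    continuous_coe_circle.measurable.aestronglyMeasurable.smul (Lp.aestronglyMeasurable f)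
  refine (Lp.memLp f).congr_norm hm (Filter.Eventually.of_forall fun z => ?_)
  simp [norm_smul, Circle.norm_coe]

/-- The forward shift `(S f)(λ) = λ f(λ)`. -/
def shift (n : ℕ) : L2 n →ₗ[ℂ] L2 n where
  toFun f := (memLp_smul_coe f).toLp _
  map_add' f g := by
    rw [← MemLp.toLp_add]
    refine MemLp.toLp_congr _ _ ?_
    filter_upwards [Lp.coeFn_add f g] with z hz
    rw [Pi.add_apply, hz, Pi.add_apply, smul_add]
  map_smul' c f := by
    rw [RingHom.id_apply, ← MemLp.toLp_const_smul]
    refine MemLp.toLp_congr _ _ ?_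
    filter_upwards [Lp.coeFn_smul c f] with z hz
    simp [hz, smul_comm c]

/-- The unitary map `f ↦ f_w`, where `f_w(λ) = f(w λ)`, for `w ∈ S¹`. -/
def rot (n : ℕ) (w : Circle) : L2 n →ₗᵢ[ℂ] L2 n :=
  Lp.compMeasurePreservingₗᵢ ℂ (fun z => w * z) (measurePreserving_mul_left arc w)

theorem measurePreserving_pow {k : ℕ} (hk : k ≠ 0) :
    MeasurePreserving (fun z : Circle => z ^ k) arc arc := by
  refine (powMonoidHom k : Circle →* Circle).measurePreserving (continuous_pow k) ?_ rfl
  intro z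
  obtain ⟨t, rfl⟩ := Circle.exp_surjective z
  refine ⟨Circle.exp (t / k), ?_⟩
  have hk' : (k : ℝ) ≠ 0 := Nat.cast_ne_zero.mpr hk
  rw [powMonoidHom_apply, ← Circle.exp_nsmul, nsmul_eq_mul, mul_div_cancel₀ _ hk']

/-- The substitution `f ↦ (λ ↦ f(λᵏ))`, for `k ≥ 1`. -/
def powSubst (n : ℕ) {k : ℕ} (hk : k ≠ 0) : L2 n →ₗᵢ[ℂ] L2 n :=
  Lp.compMeasurePreservingₗᵢ ℂ (fun z => z ^ k) (measurePreserving_pow hk)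

/-- The `m`-th Fourier coefficient `∫ λ⁻ᵐ f(λ)` of `f ∈ L²(S¹, ℂⁿ)`. -/
def coeff {n : ℕ} (m : ℤ) (f : L2 n) : Cn n :=
  ∫ z : Circle, (z : ℂ) ^ (-m) • f z ∂arc

theorem integrable_zpow_smul {n : ℕ} (m : ℤ) (f : L2 n) :
    Integrable (fun z : Circle => (z : ℂ) ^ m • f z) arc := by
  have hf : Integrable f arc := (Lp.memLp f).integrable one_le_two
  have hc : Continuous fun z : Circle => (z : ℂ) ^ m :=
    continuous_coe_circle.zpow₀ m fun z => Or.inl z.coe_ne_zero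
  refine hf.congr' (hc.measurable.aestronglyMeasurable.smul hf.aestronglyMeasurable)
    (Filter.Eventually.of_forall fun z => ?_)
  simp [norm_smul, Circle.norm_coe]

/-- The Hardy space `H₊` of `ℂⁿ`-valued functions: the `f ∈ L²(S¹, ℂⁿ)` whose Fourier coefficients
of negative index vanish. -/
def hardy (n : ℕ) : Submodule ℂ (L2 n) where
  carrier := {f | ∀ m : ℤ, m < 0 → coeff m f = 0}
  zero_mem' m _ := by
    simp [coeff]
  add_mem' {f g} hf hg m hm := by
    have h : (fun z : Circle => (z : ℂ) ^ (-m) • (f + g) z) =ᵐ[arc]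
        fun z => (z : ℂ) ^ (-m) • f z + (z : ℂ) ^ (-m) • g z := by
      filter_upwards [Lp.coeFn_add f g] with z hz
      rw [hz, Pi.add_apply, smul_add]
    have hf' := hf m hm
    have hg' := hg m hm
    unfold coeff at hf' hg' ⊢
    rw [integral_congr_ae h,
      integral_add (integrable_zpow_smul (-m) f) (integrable_zpow_smul (-m) g), hf', hg', add_zero]
  smul_mem' c f hf m hm := by
    have h : (fun z : Circle => (z : ℂ) ^ (-m) • (c • f) z) =ᵐ[arc]
        fun z => c • ((z : ℂ) ^ (-m) • f z) := by
      filter_upwards [Lp.coeFn_smul c f] with z hz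
      simp [hz, smul_comm c]
    have hf' := hf m hm
    unfold coeff at hf' ⊢
    rw [integral_congr_ae h, integral_smul, hf', smul_zero]

/-- The constant functions with value in a subspace `α ⊆ ℂⁿ`, as a subspace of `L²(S¹, ℂⁿ)`. -/
def consts {n : ℕ} (α : Submodule ℂ (Cn n)) : Submodule ℂ (L2 n) :=
  α.map (Lp.constₗ 2 arc ℂ)

/-- `T U = {T f : f ∈ U}` for an operator-valued function `T` on `S¹`, where
`(T f)(λ) = T(λ) f(λ)`. -/
def mulOp {n : ℕ} (T : Circle → Cn n →L[ℂ] Cn n) (U : Submodule ℂ (L2 n)) :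
    Submodule ℂ (L2 n) where
  carrier := {g | ∃ f ∈ U, g =ᵐ[arc] fun z => T z (f z)}
  zero_mem' := by
    refine ⟨0, U.zero_mem, ?_⟩
    filter_upwards [Lp.coeFn_zero (Cn n) 2 arc] with z hz
    rw [hz, Pi.zero_apply, map_zero]
  add_mem' := by
    rintro g g' ⟨f, hf, hg⟩ ⟨f', hf', hg'⟩
    refine ⟨f + f', U.add_mem hf hf', ?_⟩
    filter_upwards [hg, hg', Lp.coeFn_add g g', Lp.coeFn_add f f'] with z h1 h2 h3 h4
    rw [h3, h4, Pi.add_apply, Pi.add_apply, h1, h2, map_add]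
  smul_mem' := by
    rintro c g ⟨f, hf, hg⟩
    refine ⟨c • f, U.smul_mem c hf, ?_⟩
    filter_upwards [hg, Lp.coeFn_smul c g, Lp.coeFn_smul c f] with z h1 h2 h3
    rw [h2, h3, Pi.smul_apply, Pi.smul_apply, h1, map_smul]

/-- `Φ U = {Φ f : f ∈ U}` for a matrix-valued function `Φ` on `S¹`. -/
def mulMat {n : ℕ} (Φ : Circle → Matrix (Fin n) (Fin n) ℂ) (U : Submodule ℂ (L2 n)) :
    Submodule ℂ (L2 n) :=
  mulOp (fun z => Matrix.toEuclideanCLM (𝕜 := ℂ) (Φ z)) U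

/-- `Φ` is measurable and `U(n)`-valued almost everywhere on `S¹`. -/
def IsUnitaryAE {n : ℕ} (Φ : Circle → Matrix (Fin n) (Fin n) ℂ) : Prop :=
  (∀ i j, Measurable fun z => Φ z i j) ∧ ∀ᵐ z ∂arc, Φ z ∈ Matrix.unitaryGroup (Fin n) ℂ

/-- The operator `π_α + λ π_α^⊥` on `ℂⁿ` at `λ = z`, with `π_α` the orthogonal projection onto `α`. -/
def projLoop {n : ℕ} (α : Submodule ℂ (Cn n)) (z : Circle) : Cn n →L[ℂ] Cn n :=
  α.starProjection + (z : ℂ) • αᗮ.starProjection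

/-- Closed shift-invariant subspaces of `L²(S¹, ℂⁿ)`. -/
def IsShiftInvariant {n : ℕ} (W : Submodule ℂ (L2 n)) : Prop :=
  IsClosed (W : Set (L2 n)) ∧ W.map (shift n) ≤ W

/-- The symmetry condition: `f ∈ W` implies `f_ω ∈ W`. -/
def IsSymmetric {n : ℕ} (ω : Circle) (W : Submodule ℂ (L2 n)) : Prop :=
  ∀ f ∈ W, rot n ω f ∈ W

/-- The eigenspace `W_j = {f ∈ W : f_ω = ω^j f}`. -/
def eigen {n : ℕ} (ω : Circle) (W : Submodule ℂ (L2 n)) (j : ℕ) : Submodule ℂ (L2 n) :=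
  W ⊓ Module.End.eigenspace (rot n ω).toLinearMap ((ω : ℂ) ^ j)

end SymShift

end

open SymShift

noncomputable section

namespace SymShift

open scoped InnerProductSpace

/-! ### Uniqueness of Fourier coefficients on the circle -/

/-! The rotation `f ↦ f_ω` is a unitary of order `k`, so averaging over its powers against the
characters of the cyclic group splits a symmetric `W` into its eigenspaces, which are orthogonal. If
`f_ω = ω^j f`, then `λ⁻ʲ f` is invariant under `ω`, hence a function of `λᵏ`. So the isometry
`spread : f ↦ λʲ f(λᵏ)` maps `L²` onto the `j`-th eigenspace of the rotation, and `V_j`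
(`component`) is the preimage of `W` under it. Multiplication by `λ` raises `j` by one and wraps
around at `k` at the cost of a shift, which gives the chain of inclusions.

For (iii), the key is `exists_unitary_of_finrank_wandering`, a Beurling–Lax theorem in full rank.
Two functions in `V ⊖ SV` have an a.e. constant pointwise inner product, since its nonzero Fourier
coefficients vanish. Orthonormal families there are thus pointwise orthonormal, so the dimension is
at most `n`; if it equals `n`, an orthonormal basis gives the columns of a unitary `Ψ` with `V =
ΨH₊`.

Full dimension for every `V_j` comes from a count (`finrank_wandering_component`): `W ⊖ λᵏW`
contains the `kn` orthonormal vectors `Φλᵐeᵢ`, `m < k`, and is covered by the images of the `k`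
spaces `V_j ⊖ SV_j`, each of dimension at most `n`. Finally `λΨH₊ ⊆ V_j ⊆ ΨH₊`, so `V_j` is
determined by the constants `c` with `Ψc ∈ V_j`; these form `α_j`. Substituting into the
decomposition of `W` gives its formula. -/

theorem integral_continuous_smul_eq_zero {F : Type*} [NormedAddCommGroup F] [NormedSpace ℂ F]
    {h : Circle → F} (hh : Integrable h arc)
    (h0 : ∀ m : ℤ, ∫ z : Circle, (z : ℂ) ^ m • h z ∂arc = 0) (g : C(Circle, ℂ)) :
    ∫ z, g z • h z ∂arc = 0 := by
  have : Fact ((0 : ℝ) < 1) := ⟨one_pos⟩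
  let φ : AddCircle (1 : ℝ) ≃ₜ Circle := AddCircle.homeomorphCircle one_ne_zero
  have hsmul : ∀ g : C(AddCircle (1 : ℝ), ℂ), Integrable (fun z => g (φ.symm z) • h z) arc := by
    intro g
    refine hh.bdd_smul ‖g‖
      (g.continuous.comp φ.symm.continuous).measurable.aestronglyMeasurable ?_
    exact Filter.Eventually.of_forall fun z => g.norm_coe_le_norm _
  let L : C(AddCircle (1 : ℝ), ℂ) →ₗ[ℂ] F :=
    { toFun := fun g => ∫ z, g (φ.symm z) • h z ∂arc
      map_add' := fun a b => by
        rw [← integral_add (hsmul a) (hsmul b)]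
        simp [add_smul]
      map_smul' := fun c a => by
        rw [RingHom.id_apply, ← integral_smul]
        simp [mul_smul] }
  let L' : C(AddCircle (1 : ℝ), ℂ) →L[ℂ] F := L.mkContinuous (∫ z, ‖h z‖ ∂arc) fun g => by
    rw [mul_comm, ← integral_const_mul]
    refine norm_integral_le_of_norm_le (hh.norm.const_mul _)
      (Filter.Eventually.of_forall fun z => ?_)
    rw [norm_smul]
    exact mul_le_mul_of_nonneg_right (g.norm_coe_le_norm _) (norm_nonneg _)
  -- Trigonometric polynomials are uniformly dense, and integration against an integrable `h` is
  -- continuous in the sup norm, so its closed kernel is everything.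
  have hker : (⊤ : Submodule ℂ C(AddCircle (1 : ℝ), ℂ)) ≤ LinearMap.ker L'.toLinearMap := by
    rw [← span_fourier_closure_eq_top]
    refine Submodule.topologicalClosure_minimal _ ?_ L'.isClosed_ker
    rw [Submodule.span_le]
    rintro _ ⟨m, rfl⟩
    change ∫ z, fourier m (φ.symm z) • h z ∂arc = 0
    rw [← h0 m]
    congr 1 with z
    congr 1
    rw [fourier_apply, AddCircle.toCircle_zsmul, ← AddCircle.homeomorphCircle_apply one_ne_zero]
    simp [φ]
  have := hker (x := g.comp (φ : C(AddCircle (1 : ℝ), Circle))) trivial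
  change ∫ z, g (φ (φ.symm z)) • h z ∂arc = 0 at this
  simpa using this

open scoped Manifold in
-- Smooth test functions are continuous and suffice to detect zero. Integrability is the right
-- hypothesis because the pointwise inner product of two `L²` functions is only `L¹`.
theorem ae_eq_zero_of_integral_zpow_smul_eq_zero {F : Type*} [NormedAddCommGroup F]
    [NormedSpace ℂ F] [CompleteSpace F] {h : Circle → F} (hh : Integrable h arc)
    (h0 : ∀ m : ℤ, ∫ z : Circle, (z : ℂ) ^ m • h z ∂arc = 0) : ∀ᵐ z ∂arc, h z = 0 := by
  have : Fact (Module.finrank ℝ ℂ = 1 + 1) := ⟨Complex.finrank_real_complex⟩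
  refine ae_eq_zero_of_integral_contMDiff_smul_eq_zero (I := 𝓡 1) hh.locallyIntegrable
    fun g hg _ => ?_
  have := integral_continuous_smul_eq_zero hh h0
    ⟨fun z => (g z : ℂ), Complex.continuous_ofReal.comp hg.continuous⟩
  simpa using this

theorem eq_zero_of_forall_coeff_eq_zero {n : ℕ} {f : L2 n} (hf : ∀ m, coeff m f = 0) : f = 0 := by
  refine Lp.ext ?_
  have h := ae_eq_zero_of_integral_zpow_smul_eq_zero
    ((Lp.memLp f).integrable one_le_two) fun m => by simpa [coeff] using hf (-m)
  filter_upwards [h, Lp.coeFn_zero (Cn n) 2 arc] with z h1 h2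
  rw [h1, h2, Pi.zero_apply]

/-! ### Multiplication by isometry-valued functions -/

/-- A measurable function on the circle whose values are a.e. linear isometries of `ℂⁿ`. -/
structure IsIsometryAE {n : ℕ} (T : Circle → Cn n →L[ℂ] Cn n) : Prop where
  aestronglyMeasurable : AEStronglyMeasurable T arc
  norm_map : ∀ᵐ z ∂arc, ∀ v, ‖T z v‖ = ‖v‖

theorem IsIsometryAE.memLp {n : ℕ} {T : Circle → Cn n →L[ℂ] Cn n} (hT : IsIsometryAE T)
    (f : L2 n) : MemLp (fun z => T z (f z)) 2 arc := by
  have hm : AEStronglyMeasurable (fun z => T z (f z)) arc :=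
    (ContinuousLinearMap.id ℂ (Cn n →L[ℂ] Cn n)).aestronglyMeasurable_comp₂
      hT.aestronglyMeasurable (Lp.aestronglyMeasurable f)
  refine (Lp.memLp f).congr_norm hm ?_
  filter_upwards [hT.norm_map] with z hz
  rw [hz]

/-- The isometry `f ↦ T f` of `L²(S¹, ℂⁿ)`. -/
def IsIsometryAE.mul {n : ℕ} {T : Circle → Cn n →L[ℂ] Cn n} (hT : IsIsometryAE T) :
    L2 n →ₗᵢ[ℂ] L2 n where
  toFun f := (hT.memLp f).toLp _
  map_add' f g := by
    rw [← MemLp.toLp_add]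
    refine MemLp.toLp_congr _ _ ?_
    filter_upwards [Lp.coeFn_add f g] with z hz
    rw [Pi.add_apply, hz, Pi.add_apply, map_add]
  map_smul' c f := by
    rw [RingHom.id_apply, ← MemLp.toLp_const_smul]
    refine MemLp.toLp_congr _ _ ?_
    filter_upwards [Lp.coeFn_smul c f] with z hz
    simp [hz]
  norm_map' f := by
    change ‖(hT.memLp f).toLp _‖ = ‖f‖
    rw [Lp.norm_toLp, Lp.norm_def]
    congr 1
    refine eLpNorm_congr_norm_ae ?_
    filter_upwards [hT.norm_map] with z hz
    rw [hz]

theorem IsIsometryAE.coeFn_mul {n : ℕ} {T : Circle → Cn n →L[ℂ] Cn n} (hT : IsIsometryAE T)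
    (f : L2 n) : hT.mul f =ᵐ[arc] fun z => T z (f z) :=
  (hT.memLp f).coeFn_toLp

theorem IsIsometryAE.mulOp_eq_map {n : ℕ} {T : Circle → Cn n →L[ℂ] Cn n} (hT : IsIsometryAE T)
    (U : Submodule ℂ (L2 n)) : mulOp T U = U.map hT.mul.toLinearMap := by
  ext g
  constructor
  · rintro ⟨f, hf, hg⟩
    exact ⟨f, hf, Lp.ext ((hT.coeFn_mul f).trans hg.symm)⟩
  · rintro ⟨f, hf, rfl⟩
    exact ⟨f, hf, hT.coeFn_mul f⟩

theorem isIsometryAE_zpow (n : ℕ) (m : ℤ) :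
    IsIsometryAE fun z : Circle => ((z : ℂ) ^ m) • ContinuousLinearMap.id ℂ (Cn n) where
  aestronglyMeasurable := by
    have hc : Continuous fun z : Circle => (z : ℂ) ^ m :=
      continuous_coe_circle.zpow₀ m fun z => Or.inl z.coe_ne_zero
    exact (hc.smul continuous_const).aestronglyMeasurable
  norm_map := Filter.Eventually.of_forall fun z v => by simp [norm_smul, Circle.norm_coe]

/-- Multiplication by `λᵐ` on `L²(S¹, ℂⁿ)`, for `m ∈ ℤ`. -/
def zmul (n : ℕ) (m : ℤ) : L2 n →ₗᵢ[ℂ] L2 n := (isIsometryAE_zpow n m).mul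

theorem coeFn_zmul {n : ℕ} (m : ℤ) (f : L2 n) :
    zmul n m f =ᵐ[arc] fun z => (z : ℂ) ^ m • f z := by
  simpa [zmul] using (isIsometryAE_zpow n m).coeFn_mul f

theorem zmul_zmul {n : ℕ} (a b : ℤ) (f : L2 n) : zmul n a (zmul n b f) = zmul n (a + b) f := by
  refine Lp.ext ?_
  filter_upwards [coeFn_zmul a (zmul n b f), coeFn_zmul b f, coeFn_zmul (a + b) f]
    with z h1 h2 h3
  rw [h1, h2, h3, smul_smul, zpow_add₀ z.coe_ne_zero]

theorem zmul_zero {n : ℕ} (f : L2 n) : zmul n 0 f = f := by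
  refine Lp.ext ?_
  filter_upwards [coeFn_zmul 0 f] with z h1
  simp [h1]

theorem coeFn_shift {n : ℕ} (f : L2 n) : shift n f =ᵐ[arc] fun z => (z : ℂ) • f z :=
  (memLp_smul_coe f).coeFn_toLp

theorem shift_eq_zmul {n : ℕ} (f : L2 n) : shift n f = zmul n 1 f := by
  refine Lp.ext ?_
  filter_upwards [coeFn_shift f, coeFn_zmul 1 f] with z h1 h2
  simp [h1, h2]

theorem shift_pow_eq_zmul {n : ℕ} (j : ℕ) (f : L2 n) : (shift n ^ j) f = zmul n j f := by
  induction j with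
  | zero => simp [zmul_zero]
  | succ j ih =>
    rw [pow_succ', Module.End.mul_apply, ih, shift_eq_zmul, zmul_zmul]
    congr 2
    push_cast
    ring

theorem inner_zmul_right {n : ℕ} (m : ℤ) (f g : L2 n) :
    ⟪f, zmul n m g⟫_ℂ = ⟪zmul n (-m) f, g⟫_ℂ := by
  rw [← (zmul n m).inner_map_map (zmul n (-m) f) g, zmul_zmul, add_neg_cancel, zmul_zero]

/-! ### Fourier coefficients and the Hardy space -/

/-- The constant function with value `c`. -/
abbrev cst {n : ℕ} (c : Cn n) : L2 n := Lp.constₗ 2 arc ℂ c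

theorem coeFn_cst {n : ℕ} (c : Cn n) : cst c =ᵐ[arc] fun _ => c :=
  Lp.coeFn_const 2 arc c

/-- Coefficients become inner products with `λᵐ c`, so vanishing of a coefficient is a closed
condition that can be transported along isometries. -/
theorem inner_cst_zmul {n : ℕ} (m : ℤ) (c : Cn n) (f : L2 n) :
    ⟪zmul n m (cst c), f⟫_ℂ = ⟪c, coeff m f⟫_ℂ := by
  have h := integrable_zpow_smul (-m) f
  rw [coeff, ← integral_inner h, ← neg_neg m, ← inner_zmul_right, neg_neg, L2.inner_def]
  refine integral_congr_ae ?_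
  filter_upwards [coeFn_cst c, coeFn_zmul (-m) f] with z h1 h2
  rw [h1, h2]

theorem coeff_eq_zero_iff {n : ℕ} (m : ℤ) (f : L2 n) :
    coeff m f = 0 ↔ ∀ c, ⟪zmul n m (cst c), f⟫_ℂ = 0 := by
  simp only [inner_cst_zmul]
  exact ⟨fun h c => by rw [h, inner_zero_right], fun h => inner_self_eq_zero.mp (h _)⟩

theorem coeff_zmul {n : ℕ} (m a : ℤ) (f : L2 n) : coeff m (zmul n a f) = coeff (m - a) f := by
  unfold coeff
  refine integral_congr_ae ?_
  filter_upwards [coeFn_zmul a f] with z h1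
  rw [h1, smul_smul, ← zpow_add₀ z.coe_ne_zero]
  congr 2
  ring

theorem coeff_sub {n : ℕ} (m : ℤ) (f g : L2 n) : coeff m (f - g) = coeff m f - coeff m g := by
  refine ext_inner_left ℂ fun c => ?_
  rw [inner_sub_right, ← inner_cst_zmul, ← inner_cst_zmul, ← inner_cst_zmul, inner_sub_right]

theorem integral_zpow {m : ℤ} (hm : m ≠ 0) : ∫ z : Circle, (z : ℂ) ^ m ∂arc = 0 := by
  have h : ∀ w : Circle, (∫ z : Circle, (z : ℂ) ^ m ∂arc) =
      (w : ℂ) ^ m * ∫ z : Circle, (z : ℂ) ^ m ∂arc := by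
    intro w
    rw [← integral_const_mul, ← integral_mul_left_eq_self (fun z : Circle => (z : ℂ) ^ m) w]
    simp [mul_zpow]
  by_contra h0
  -- This rotation satisfies `wᵐ = -1`, so rotation invariance makes the integral equal to its
  -- negative.
  have hw := h (Circle.exp (Real.pi / m))
  have hm' : (m : ℂ) ≠ 0 := Int.cast_ne_zero.mpr hm
  have : ((Circle.exp (Real.pi / m) : Circle) : ℂ) ^ m = -1 := by
    rw [Circle.coe_exp, ← Complex.exp_int_mul, ← Complex.exp_pi_mul_I]
    congr 1
    push_cast
    field_simp
  rw [this] at hw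
  exact h0 (by linear_combination hw / 2)

theorem coeff_cst {n : ℕ} (m : ℤ) (c : Cn n) : coeff m (cst c) = if m = 0 then c else 0 := by
  have : coeff m (cst c) = (∫ z : Circle, (z : ℂ) ^ (-m) ∂arc) • c := by
    rw [coeff, ← integral_smul_const]
    refine integral_congr_ae ?_
    filter_upwards [coeFn_cst c] with z h
    rw [h]
  rw [this]
  split_ifs with h
  · simp [h]
  · rw [integral_zpow (neg_ne_zero.mpr h), zero_smul]

theorem mem_hardy {n : ℕ} {f : L2 n} : f ∈ hardy n ↔ ∀ m : ℤ, m < 0 → coeff m f = 0 := Iff.rfl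

theorem zmul_mem_hardy {n : ℕ} {m : ℤ} (hm : 0 ≤ m) {f : L2 n} (hf : f ∈ hardy n) :
    zmul n m f ∈ hardy n := fun a ha => by
  rw [coeff_zmul]
  exact hf _ (by omega)

theorem cst_mem_hardy {n : ℕ} (c : Cn n) : cst c ∈ hardy n := fun m hm => by
  rw [coeff_cst, if_neg hm.ne]

/-- Every `f` in the Hardy space is `f(0) + λ h` with `h` in the Hardy space. -/
theorem exists_eq_cst_add_zmul {n : ℕ} {f : L2 n} (hf : f ∈ hardy n) :
    ∃ c, ∃ h ∈ hardy n, f = cst c + zmul n 1 h := by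
  refine ⟨coeff 0 f, zmul n (-1) (f - cst (coeff 0 f)), fun m hm => ?_, ?_⟩
  · rw [coeff_zmul, coeff_sub, coeff_cst]
    split_ifs with h
    · rw [h, sub_self]
    · rw [hf _ (by omega), sub_zero]
  · rw [zmul_zmul, add_neg_cancel, zmul_zero, add_sub_cancel]

/-- A closed subspace containing all `λᵐ c` with `m ≥ 0` contains the Hardy space. -/
theorem hardy_le_of_zmul_cst_mem {n : ℕ} {V : Submodule ℂ (L2 n)}
    (hV : IsClosed (V : Set (L2 n))) (h : ∀ (m : ℕ) c, zmul n m (cst c) ∈ V) : hardy n ≤ V := by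
  let A : Submodule ℂ (L2 n) :=
    (Submodule.span ℂ {g | ∃ (m : ℕ) (c : Cn n), zmul n m (cst c) = g}).topologicalClosure
  have hA : ∀ (m : ℕ) c, zmul n m (cst c) ∈ A := fun m c =>
    Submodule.le_topologicalClosure _ (Submodule.subset_span ⟨m, c, rfl⟩)
  have hAV : A ≤ V := by
    refine Submodule.topologicalClosure_minimal _ ?_ hV
    rw [Submodule.span_le]
    rintro _ ⟨m, c, rfl⟩
    exact h m c
  have hneg : ∀ a ∈ A, ∀ m : ℤ, m < 0 → coeff m a = 0 := by
    intro a ha m hm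
    rw [coeff_eq_zero_iff]
    intro c
    have : A ≤ (ℂ ∙ zmul n m (cst c))ᗮ := by
      refine Submodule.topologicalClosure_minimal _ ?_ (Submodule.isClosed_orthogonal _)
      rw [Submodule.span_le]
      rintro _ ⟨l, d, rfl⟩
      refine (Submodule.mem_orthogonal_singleton_iff_inner_right).mpr ?_
      rw [inner_cst_zmul, coeff_zmul, coeff_cst, if_neg (by omega), inner_zero_right]
    exact (Submodule.mem_orthogonal_singleton_iff_inner_right).mp (this ha)
  have : CompleteSpace A := (Submodule.isClosed_topologicalClosure _).completeSpace_coe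
  intro f hf
  -- Negative coefficients vanish for `f` and on `A`; the others vanish because the difference is
  -- orthogonal to `A`.
  have hz : f - A.starProjection f = 0 := by
    refine eq_zero_of_forall_coeff_eq_zero fun m => ?_
    rcases lt_or_ge m 0 with hm | hm
    · rw [coeff_sub, hf m hm, hneg _ (A.starProjection_apply_mem f) m hm, sub_zero]
    · rw [coeff_eq_zero_iff]
      intro c
      obtain ⟨l, rfl⟩ := Int.eq_ofNat_of_zero_le hm
      exact (A.sub_starProjection_mem_orthogonal f) _ (hA l c)
  rw [sub_eq_zero.mp hz]
  exact hAV (A.starProjection_apply_mem f)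

/-! ### Rotations and the eigenspace decomposition -/

theorem coeFn_rot {n : ℕ} (w : Circle) (f : L2 n) : rot n w f =ᵐ[arc] fun z => f (w * z) :=
  Lp.coeFn_compMeasurePreserving f (measurePreserving_mul_left arc w)

theorem coeFn_powSubst {n k : ℕ} (hk : k ≠ 0) (f : L2 n) :
    powSubst n hk f =ᵐ[arc] fun z => f (z ^ k) :=
  Lp.coeFn_compMeasurePreserving f (measurePreserving_pow hk)

theorem ae_mul_left {p : Circle → Prop} (w : Circle) (h : ∀ᵐ z ∂arc, p z) :
    ∀ᵐ z ∂arc, p (w * z) :=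
  (measurePreserving_mul_left arc w).quasiMeasurePreserving.ae h

theorem ae_pow {p : Circle → Prop} {k : ℕ} (hk : k ≠ 0) (h : ∀ᵐ z ∂arc, p z) :
    ∀ᵐ z ∂arc, p (z ^ k) :=
  (measurePreserving_pow hk).quasiMeasurePreserving.ae h

theorem rot_rot {n : ℕ} (a b : Circle) (f : L2 n) : rot n a (rot n b f) = rot n (a * b) f := by
  refine Lp.ext ?_
  filter_upwards [coeFn_rot a (rot n b f), ae_mul_left a (coeFn_rot b f), coeFn_rot (a * b) f]
    with z h1 h2 h3
  rw [h1, h2, h3, mul_comm a b, mul_assoc]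

theorem rot_one {n : ℕ} (f : L2 n) : rot n 1 f = f := by
  refine Lp.ext ?_
  filter_upwards [coeFn_rot 1 f] with z h
  rw [h, one_mul]

theorem rot_zmul {n : ℕ} (w : Circle) (m : ℤ) (f : L2 n) :
    rot n w (zmul n m f) = (w : ℂ) ^ m • zmul n m (rot n w f) := by
  refine Lp.ext ?_
  filter_upwards [coeFn_rot w (zmul n m f), ae_mul_left w (coeFn_zmul m f),
    coeFn_zmul m (rot n w f), coeFn_rot w f, Lp.coeFn_smul ((w : ℂ) ^ m) (zmul n m (rot n w f))]
    with z h1 h2 h3 h4 h5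
  rw [h1, h2, h5, Pi.smul_apply, h3, h4, smul_smul, Circle.coe_mul, mul_zpow]

theorem powSubst_zmul {n k : ℕ} (hk : k ≠ 0) (m : ℤ) (f : L2 n) :
    powSubst n hk (zmul n m f) = zmul n (k * m) (powSubst n hk f) := by
  refine Lp.ext ?_
  filter_upwards [coeFn_powSubst hk (zmul n m f), ae_pow hk (coeFn_zmul m f),
    coeFn_zmul (k * m) (powSubst n hk f), coeFn_powSubst hk f] with z h1 h2 h3 h4
  rw [h1, h2, h3, h4, Circle.coe_pow, zpow_mul, zpow_natCast]

theorem rot_powSubst {n k : ℕ} (hk : k ≠ 0) {w : Circle} (hw : w ^ k = 1) (f : L2 n) :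
    rot n w (powSubst n hk f) = powSubst n hk f := by
  refine Lp.ext ?_
  filter_upwards [coeFn_rot w (powSubst n hk f), ae_mul_left w (coeFn_powSubst hk f),
    coeFn_powSubst hk f] with z h1 h2 h3
  rw [h1, h2, h3, mul_pow, hw, one_mul]

theorem powSubst_cst {n k : ℕ} (hk : k ≠ 0) (c : Cn n) : powSubst n hk (cst c) = cst c := by
  refine Lp.ext ?_
  filter_upwards [coeFn_powSubst hk (cst c), ae_pow hk (coeFn_cst c), coeFn_cst c] with z h1 h2 h3
  rw [h1, h2, h3]

theorem rot_pow_of_mem_eigenspace {n : ℕ} {w : Circle} {μ : ℂ} {f : L2 n}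
    (hf : rot n w f = μ • f) (l : ℕ) : rot n (w ^ l) f = μ ^ l • f := by
  induction l with
  | zero => simp [rot_one]
  | succ l ih => rw [pow_succ', ← rot_rot, ih, map_smul, hf, smul_smul, ← pow_succ]

theorem rot_pow_mem {n : ℕ} {w : Circle} {W : Submodule ℂ (L2 n)} (hW : IsSymmetric w W)
    {f : L2 n} (hf : f ∈ W) (l : ℕ) : rot n (w ^ l) f ∈ W := by
  induction l with
  | zero => simpa [rot_one] using hf
  | succ l ih => rw [pow_succ', ← rot_rot]; exact hW _ ih

theorem mem_eigen {n : ℕ} {w : Circle} {W : Submodule ℂ (L2 n)} {j : ℕ} {f : L2 n} :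
    f ∈ eigen w W j ↔ f ∈ W ∧ rot n w f = (w : ℂ) ^ j • f := by
  simp [eigen]

/-- The unnormalized projection `f ↦ ∑ₗ ω⁻ˡʲ f(ωˡ λ)` onto the `j`-th eigenspace. -/
def average {n : ℕ} (k : ℕ) (ω : Circle) (j : ℕ) (f : L2 n) : L2 n :=
  ∑ l ∈ Finset.range k, ((ω : ℂ) ^ (l * j))⁻¹ • rot n (ω ^ l) f

theorem average_mem {n k : ℕ} {ω : Circle} {W : Submodule ℂ (L2 n)} (hW : IsSymmetric ω W)
    (j : ℕ) {f : L2 n} (hf : f ∈ W) : average k ω j f ∈ W :=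
  W.sum_mem fun l _ => W.smul_mem _ (rot_pow_mem hW hf l)

/-- Rotating shifts the summation index by one, and the summand has period `k` in `l` because `ω^k =
1`. -/
theorem rot_average {n k : ℕ} {ω : Circle} (hω : ω ^ k = 1) (j : ℕ) (f : L2 n) :
    rot n ω (average k ω j f) = (ω : ℂ) ^ j • average k ω j f := by
  have hω' : (ω : ℂ) ^ k = 1 := by rw [← Circle.coe_pow, hω, Circle.coe_one]
  let a : ℕ → L2 n := fun l => ((ω : ℂ) ^ (l * j))⁻¹ • rot n (ω ^ l) f
  have hstep : ∀ l, rot n ω (a l) = (ω : ℂ) ^ j • a (l + 1) := by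
    intro l
    simp only [a]
    rw [map_smul, rot_rot, ← pow_succ', smul_smul]
    congr 1
    have := ω.coe_ne_zero
    field_simp
    ring
  have hper : a k = a 0 := by
    simp only [a]
    rw [pow_mul, hω', hω]
    simp
  have hsum : ∑ l ∈ Finset.range k, a (l + 1) = ∑ l ∈ Finset.range k, a l := by
    have h1 := Finset.sum_range_succ a k
    rw [Finset.sum_range_succ', hper] at h1
    exact add_right_cancel h1
  change rot n ω (∑ l ∈ Finset.range k, a l) = (ω : ℂ) ^ j • ∑ l ∈ Finset.range k, a l
  rw [map_sum, ← hsum, Finset.smul_sum]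
  exact Finset.sum_congr rfl fun l _ => hstep l

theorem average_of_mem {n k : ℕ} {ω : Circle} {j : ℕ} {f : L2 n}
    (hf : rot n ω f = (ω : ℂ) ^ j • f) : average k ω j f = (k : ℂ) • f := by
  have : ∀ l ∈ Finset.range k, ((ω : ℂ) ^ (l * j))⁻¹ • rot n (ω ^ l) f = f := by
    intro l _
    rw [rot_pow_of_mem_eigenspace hf, smul_smul, ← pow_mul, mul_comm j l,
      inv_mul_cancel₀ (pow_ne_zero _ ω.coe_ne_zero), one_smul]
  rw [average, Finset.sum_congr rfl this]
  simp [Nat.cast_smul_eq_nsmul]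

theorem isPrimitiveRoot_coe {k : ℕ} {ω : Circle} (hω : IsPrimitiveRoot ω k) :
    IsPrimitiveRoot (ω : ℂ) k :=
  hω.map_of_injective (f := Circle.coeHom) Subtype.val_injective

/-- After exchanging the sums, the geometric sum of `ω⁻ˡʲ` over `j` vanishes for `0 < l < k`; only
`l = 0` survives. -/
theorem sum_average {n k : ℕ} {ω : Circle} (hω : IsPrimitiveRoot ω k) (f : L2 n) :
    ∑ j ∈ Finset.range k, average k ω j f = (k : ℂ) • f := by
  have hω' := isPrimitiveRoot_coe hω
  unfold average
  rw [Finset.sum_comm]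
  rcases Nat.eq_zero_or_pos k with rfl | hk
  · simp
  rw [Finset.sum_eq_single 0]
  · simp [rot_one, Nat.cast_smul_eq_nsmul]
  · intro l hl hl0
    rw [← Finset.sum_smul]
    have h1 : ((ω : ℂ) ^ l)⁻¹ ≠ 1 := by
      rw [ne_eq, inv_eq_one]
      exact hω'.pow_ne_one_of_pos_of_lt hl0 (Finset.mem_range.mp hl)
    have h2 : (((ω : ℂ) ^ l)⁻¹) ^ k = 1 := by
      rw [inv_pow, ← pow_mul, mul_comm, pow_mul, hω'.pow_eq_one, one_pow, inv_one]
    have h3 : ∑ j ∈ Finset.range k, ((ω : ℂ) ^ (l * j))⁻¹ = 0 := by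
      have := geom_sum_mul (((ω : ℂ) ^ l)⁻¹) k
      rw [h2, sub_self] at this
      simpa only [pow_mul, inv_pow] using
        (mul_eq_zero.mp this).resolve_right (sub_ne_zero.mpr h1)
    rw [h3, zero_smul]
  · intro h
    exact absurd (Finset.mem_range.mpr hk) h

theorem eigen_eq_setOf_average {n k : ℕ} (hk : k ≠ 0) {ω : Circle} (hω : ω ^ k = 1)
    {W : Submodule ℂ (L2 n)} (j : ℕ) :
    (eigen ω W j : Set (L2 n)) = {g | g ∈ W ∧ ∃ f ∈ W, g = average k ω j f} := by
  ext g
  constructor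
  · intro hg
    obtain ⟨hgW, hg⟩ := mem_eigen.mp hg
    -- The average is unnormalized: it multiplies an eigenvector by `k`.
    refine ⟨hgW, (k : ℂ)⁻¹ • g, W.smul_mem _ hgW, ?_⟩
    rw [average_of_mem (by rw [map_smul, hg, smul_comm]), smul_smul,
      mul_inv_cancel₀ (Nat.cast_ne_zero.mpr hk), one_smul]
  · rintro ⟨hgW, f, -, rfl⟩
    exact mem_eigen.mpr ⟨hgW, rot_average hω j f⟩

theorem isClosed_eigen {n : ℕ} (ω : Circle) {W : Submodule ℂ (L2 n)}
    (hW : IsClosed (W : Set (L2 n))) (j : ℕ) : IsClosed (eigen ω W j : Set (L2 n)) := by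
  have : (eigen ω W j : Set (L2 n)) = (W : Set (L2 n)) ∩ {f | rot n ω f = (ω : ℂ) ^ j • f} := by
    ext f
    exact mem_eigen
  rw [this]
  exact hW.inter (isClosed_eq (rot n ω).continuous (continuous_const_smul _))

theorem eq_iSup_eigen {n k : ℕ} (hk : k ≠ 0) {ω : Circle} (hω : IsPrimitiveRoot ω k)
    {W : Submodule ℂ (L2 n)} (hW : IsSymmetric ω W) : W = ⨆ j : Fin k, eigen ω W j := by
  refine le_antisymm (fun f hf => ?_) (iSup_le fun j => inf_le_left)
  have hf' : f = (k : ℂ)⁻¹ • ∑ j : Fin k, average k ω j f := by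
    rw [Fin.sum_univ_eq_sum_range (fun j => average k ω j f), sum_average hω, smul_smul,
      inv_mul_cancel₀ (Nat.cast_ne_zero.mpr hk), one_smul]
  rw [hf']
  refine Submodule.smul_mem _ _ (Submodule.sum_mem _ fun j _ => ?_)
  exact Submodule.mem_iSup_of_mem j
    (mem_eigen.mpr ⟨average_mem hW j hf, rot_average hω.pow_eq_one j f⟩)

/-- The rotation preserves inner products, so a nonzero `⟪f, g⟫` would force `ω^i = ω^j`, hence `i =
j`. -/
theorem eigen_isOrtho {n k : ℕ} {ω : Circle} (hω : IsPrimitiveRoot ω k)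
    (W : Submodule ℂ (L2 n)) :
    Pairwise fun i j : Fin k => eigen ω W i ⟂ eigen ω W j := by
  intro i j hij
  rw [Submodule.isOrtho_iff_inner_eq]
  intro f hf g hg
  have h := (rot n ω).inner_map_map f g
  rw [(mem_eigen.mp hf).2, (mem_eigen.mp hg).2, inner_smul_left, inner_smul_right, map_pow,
    ← Circle.coe_inv_eq_conj] at h
  by_contra h0
  rw [← mul_assoc, mul_eq_right₀ h0, Circle.coe_inv, inv_pow,
    inv_mul_eq_one₀ (pow_ne_zero _ ω.coe_ne_zero)] at h
  exact hij (Fin.ext ((isPrimitiveRoot_coe hω).pow_inj i.2 j.2 h))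

theorem eigen_iSupIndep {n k : ℕ} {ω : Circle} (hω : IsPrimitiveRoot ω k)
    (W : Submodule ℂ (L2 n)) : iSupIndep fun j : Fin k => eigen ω W j :=
  (OrthogonalFamily.of_pairwise (eigen_isOrtho hω W)).independent

/-! ### Rotation-invariant functions are functions of `λᵏ` -/

/-- The principal argument gives a measurable section `s` of `z ↦ zᵏ`, and `g = f ∘ s` works:
`s(zᵏ)` and `z` differ by a power of `ω`, under which `f` is invariant. -/
theorem exists_powSubst_eq {n k : ℕ} (hk : k ≠ 0) {ω : Circle} (hω : IsPrimitiveRoot ω k)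
    {f : L2 n} (hf : rot n ω f = f) : ∃ g, powSubst n hk g = f := by
  let s : Circle → Circle := fun z => Circle.exp (Complex.arg z / k)
  have hs : Measurable s := Circle.exp.continuous.measurable.comp
    ((Complex.measurable_arg.comp continuous_coe_circle.measurable).div_const _)
  have hsk : ∀ z, s z ^ k = z := fun z => by
    have hk' : (k : ℝ) ≠ 0 := Nat.cast_ne_zero.mpr hk
    rw [← Circle.exp_nsmul, nsmul_eq_mul, mul_div_cancel₀ _ hk', Circle.exp_arg]
  have hlift : ∀ z : Circle, ∃ l : ℕ, s (z ^ k) = ω ^ l * z := by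
    intro z
    have h1 : ((s (z ^ k) / z : Circle) : ℂ) ^ k = 1 := by
      rw [← Circle.coe_pow, div_pow, hsk, div_self', Circle.coe_one]
    have : NeZero k := ⟨hk⟩
    obtain ⟨l, -, hl⟩ := (isPrimitiveRoot_coe hω).eq_pow_of_pow_eq_one h1
    refine ⟨l, ?_⟩
    rw [← Circle.coe_pow] at hl
    rw [Circle.ext hl, div_mul_cancel]
  -- One null set must serve all `l`, since the exponent found in `hlift` depends on `z`.
  have hinv : ∀ᵐ z ∂arc, ∀ l : ℕ, f (ω ^ l * z) = f z := by
    rw [ae_all_iff]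
    intro l
    have h := rot_pow_of_mem_eigenspace (μ := 1) (by rw [hf, one_smul]) l
    rw [one_pow, one_smul] at h
    filter_upwards [coeFn_rot (ω ^ l) f] with z hz
    rw [← hz, h]
  have hcomp : (fun z => f (s z)) ∘ (fun z : Circle => z ^ k) =ᵐ[arc] f := by
    filter_upwards [hinv] with z hz
    obtain ⟨l, hl⟩ := hlift z
    simp only [Function.comp_apply]
    rw [hl, hz]
  -- The chosen representative of `f` is strongly measurable, so `s` need not be known to respect
  -- null sets.
  have hm : AEStronglyMeasurable (fun z => f (s z)) arc :=
    ((Lp.stronglyMeasurable f).comp_measurable hs).aestronglyMeasurable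
  have hg : MemLp (fun z => f (s z)) 2 arc := by
    refine ⟨hm, ?_⟩
    rw [← eLpNorm_comp_measurePreserving hm (measurePreserving_pow hk), eLpNorm_congr_ae hcomp]
    exact (Lp.memLp f).2
  refine ⟨hg.toLp _, Lp.ext ?_⟩
  filter_upwards [coeFn_powSubst hk (hg.toLp _), ae_pow hk hg.coeFn_toLp, hcomp] with z h1 h2 h3
  rw [h1, h2]
  exact h3

/-! ### The filtration -/

/-- The isometry `f ↦ λʲ f(λᵏ)`. -/
def spread (n : ℕ) {k : ℕ} (hk : k ≠ 0) (j : ℕ) : L2 n →ₗᵢ[ℂ] L2 n :=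
  (zmul n j).comp (powSubst n hk)

theorem spread_apply {n k : ℕ} (hk : k ≠ 0) (j : ℕ) (f : L2 n) :
    spread n hk j f = zmul n j (powSubst n hk f) := rfl

theorem map_spread {n k : ℕ} (hk : k ≠ 0) (j : ℕ) (V : Submodule ℂ (L2 n)) :
    V.map (spread n hk j).toLinearMap =
      (V.map (powSubst n hk).toLinearMap).map (shift n ^ j) := by
  rw [← Submodule.map_comp]
  congr 1
  ext1 f
  simp [spread_apply, shift_pow_eq_zmul]

theorem spread_zmul {n k : ℕ} (hk : k ≠ 0) (j : ℕ) (m : ℤ) (f : L2 n) :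
    spread n hk j (zmul n m f) = zmul n (k * m) (spread n hk j f) := by
  rw [spread_apply, spread_apply, powSubst_zmul, zmul_zmul, zmul_zmul, add_comm]

theorem zmul_spread {n k : ℕ} (hk : k ≠ 0) (i j : ℕ) (f : L2 n) :
    zmul n i (spread n hk j f) = spread n hk (i + j) f := by
  rw [spread_apply, spread_apply, zmul_zmul, Nat.cast_add]

theorem rot_spread {n k : ℕ} (hk : k ≠ 0) {ω : Circle} (hω : ω ^ k = 1) (j : ℕ) (f : L2 n) :
    rot n ω (spread n hk j f) = (ω : ℂ) ^ j • spread n hk j f := by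
  rw [spread_apply, rot_zmul, rot_powSubst hk hω, zpow_natCast]

theorem exists_spread_eq {n k : ℕ} (hk : k ≠ 0) {ω : Circle} (hω : IsPrimitiveRoot ω k)
    {j : ℕ} {f : L2 n} (hf : rot n ω f = (ω : ℂ) ^ j • f) : ∃ g, spread n hk j g = f := by
  have h : rot n ω (zmul n (-j) f) = zmul n (-j) f := by
    rw [rot_zmul, hf, map_smul, smul_smul, zpow_neg, zpow_natCast,
      inv_mul_cancel₀ (pow_ne_zero _ ω.coe_ne_zero), one_smul]
  obtain ⟨g, hg⟩ := exists_powSubst_eq hk hω h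
  exact ⟨g, by rw [spread_apply, hg, zmul_zmul, add_neg_cancel, zmul_zero]⟩

/-- The subspace `V_j = {f : λʲ f(λᵏ) ∈ W}`. -/
def component {n k : ℕ} (hk : k ≠ 0) (W : Submodule ℂ (L2 n)) (j : ℕ) : Submodule ℂ (L2 n) :=
  W.comap (spread n hk j).toLinearMap

theorem mem_component {n k : ℕ} {hk : k ≠ 0} {W : Submodule ℂ (L2 n)} {j : ℕ} {f : L2 n} :
    f ∈ component hk W j ↔ spread n hk j f ∈ W := Iff.rfl

theorem eigen_eq_map_spread {n k : ℕ} (hk : k ≠ 0) {ω : Circle} (hω : IsPrimitiveRoot ω k)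
    (W : Submodule ℂ (L2 n)) (j : ℕ) :
    eigen ω W j = (component hk W j).map (spread n hk j).toLinearMap := by
  ext f
  constructor
  · intro hf
    obtain ⟨hfW, hf⟩ := mem_eigen.mp hf
    obtain ⟨g, rfl⟩ := exists_spread_eq hk hω hf
    exact ⟨g, hfW, rfl⟩
  · rintro ⟨g, hg, rfl⟩
    exact mem_eigen.mpr ⟨hg, rot_spread hk hω.pow_eq_one j g⟩

theorem IsShiftInvariant.zmul_mem {n : ℕ} {W : Submodule ℂ (L2 n)} (hW : IsShiftInvariant W)
    (m : ℕ) {f : L2 n} (hf : f ∈ W) : zmul n m f ∈ W := by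
  rw [← shift_pow_eq_zmul]
  induction m with
  | zero => simpa using hf
  | succ m ih =>
    rw [pow_succ', Module.End.mul_apply]
    exact hW.2 ⟨_, ih, rfl⟩

theorem isShiftInvariant_component {n k : ℕ} (hk : k ≠ 0) {W : Submodule ℂ (L2 n)}
    (hW : IsShiftInvariant W) (j : ℕ) : IsShiftInvariant (component hk W j) := by
  refine ⟨hW.1.preimage (spread n hk j).continuous, ?_⟩
  rintro _ ⟨f, hf, rfl⟩
  rw [mem_component, shift_eq_zmul, spread_zmul, mul_one]
  exact hW.zmul_mem k hf

theorem component_le_succ {n k : ℕ} (hk : k ≠ 0) {W : Submodule ℂ (L2 n)}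
    (hW : IsShiftInvariant W) (j : ℕ) :
    component hk W j ≤ component hk W (j + 1) := by
  intro f hf
  rw [mem_component, add_comm, ← zmul_spread]
  exact hW.zmul_mem 1 hf

/-- This is the wrap-around `λ · λᵏ⁻¹ f(λᵏ) = (λf)(λᵏ)`. -/
theorem map_shift_component_le {n k : ℕ} (hk : k ≠ 0) {W : Submodule ℂ (L2 n)}
    (hW : IsShiftInvariant W) :
    (component hk W (k - 1)).map (shift n) ≤ component hk W 0 := by
  rintro _ ⟨f, hf, rfl⟩
  rw [mem_component, shift_eq_zmul, spread_zmul, mul_one, zmul_spread]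
  have := hW.zmul_mem 1 (mem_component.mp hf)
  rw [zmul_spread] at this
  convert this using 3
  omega

/-! ### Unitary-valued functions -/

theorem norm_toEuclideanCLM_of_mem_unitaryGroup {n : ℕ} {A : Matrix (Fin n) (Fin n) ℂ}
    (hA : A ∈ Matrix.unitaryGroup (Fin n) ℂ) (v : Cn n) :
    ‖Matrix.toEuclideanCLM (𝕜 := ℂ) A v‖ = ‖v‖ := by
  have h : Matrix.toEuclideanCLM (𝕜 := ℂ) A ∈ unitary (Cn n →L[ℂ] Cn n) :=
    Unitary.map_mem _ hA
  exact ContinuousLinearMap.norm_map_of_mem_unitary h v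

theorem aestronglyMeasurable_toEuclideanCLM {n : ℕ} {Φ : Circle → Matrix (Fin n) (Fin n) ℂ}
    (h : ∀ i j, Measurable fun z => Φ z i j) :
    AEStronglyMeasurable (fun z => Matrix.toEuclideanCLM (𝕜 := ℂ) (Φ z)) arc := by
  have : (fun z => Matrix.toEuclideanCLM (𝕜 := ℂ) (Φ z)) = fun z => ∑ i, ∑ j,
      Φ z i j • Matrix.toEuclideanCLM (𝕜 := ℂ) (Matrix.single i j (1 : ℂ)) := by
    funext z
    conv_lhs => rw [Matrix.matrix_eq_sum_single (Φ z)]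
    simp only [map_sum]
    refine Finset.sum_congr rfl fun i _ => Finset.sum_congr rfl fun j _ => ?_
    rw [← map_smul, Matrix.smul_single, smul_eq_mul, mul_one]
  rw [this]
  exact Finset.aestronglyMeasurable_fun_sum _ fun i _ =>
    Finset.aestronglyMeasurable_fun_sum _ fun j _ =>
      (h i j).aestronglyMeasurable.smul_const _

theorem IsUnitaryAE.isIsometryAE {n : ℕ} {Φ : Circle → Matrix (Fin n) (Fin n) ℂ}
    (hΦ : IsUnitaryAE Φ) : IsIsometryAE fun z => Matrix.toEuclideanCLM (𝕜 := ℂ) (Φ z) where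
  aestronglyMeasurable := aestronglyMeasurable_toEuclideanCLM hΦ.1
  norm_map := hΦ.2.mono fun _ hz => norm_toEuclideanCLM_of_mem_unitaryGroup hz

/-- The isometry `f ↦ Φ f` of `L²(S¹, ℂⁿ)`. -/
def IsUnitaryAE.mul {n : ℕ} {Φ : Circle → Matrix (Fin n) (Fin n) ℂ} (hΦ : IsUnitaryAE Φ) :
    L2 n →ₗᵢ[ℂ] L2 n := hΦ.isIsometryAE.mul

theorem IsUnitaryAE.coeFn_mul {n : ℕ} {Φ : Circle → Matrix (Fin n) (Fin n) ℂ}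
    (hΦ : IsUnitaryAE Φ) (f : L2 n) :
    hΦ.mul f =ᵐ[arc] fun z => Matrix.toEuclideanCLM (𝕜 := ℂ) (Φ z) (f z) :=
  hΦ.isIsometryAE.coeFn_mul f

theorem IsUnitaryAE.mulMat_eq_map {n : ℕ} {Φ : Circle → Matrix (Fin n) (Fin n) ℂ}
    (hΦ : IsUnitaryAE Φ) (U : Submodule ℂ (L2 n)) : mulMat Φ U = U.map hΦ.mul.toLinearMap :=
  hΦ.isIsometryAE.mulOp_eq_map U

theorem IsUnitaryAE.mul_zmul {n : ℕ} {Φ : Circle → Matrix (Fin n) (Fin n) ℂ}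
    (hΦ : IsUnitaryAE Φ) (m : ℤ) (f : L2 n) : hΦ.mul (zmul n m f) = zmul n m (hΦ.mul f) := by
  refine Lp.ext ?_
  filter_upwards [hΦ.coeFn_mul (zmul n m f), coeFn_zmul m f, coeFn_zmul m (hΦ.mul f),
    hΦ.coeFn_mul f] with z h1 h2 h3 h4
  rw [h1, h2, h3, h4, map_smul]

theorem IsUnitaryAE.conjTranspose {n : ℕ} {Φ : Circle → Matrix (Fin n) (Fin n) ℂ}
    (hΦ : IsUnitaryAE Φ) : IsUnitaryAE fun z => (Φ z).conjTranspose := by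
  refine ⟨fun i j => ?_, hΦ.2.mono fun z hz => Unitary.star_mem hz⟩
  exact Complex.continuous_conj.measurable.comp (hΦ.1 j i)

theorem IsUnitaryAE.mul_conjTranspose_mul {n : ℕ} {Φ : Circle → Matrix (Fin n) (Fin n) ℂ}
    (hΦ : IsUnitaryAE Φ) (f : L2 n) : hΦ.mul (hΦ.conjTranspose.mul f) = f := by
  refine Lp.ext ?_
  filter_upwards [hΦ.coeFn_mul (hΦ.conjTranspose.mul f), hΦ.conjTranspose.coeFn_mul f, hΦ.2]
    with z h1 h2 h3
  rw [h1, h2, ← mul_apply_eq_comp, ← map_mul, ← Matrix.star_eq_conjTranspose,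
    Matrix.mem_unitaryGroup_iff.mp h3, map_one, one_apply_eq_self]

theorem IsUnitaryAE.comp_pow {n k : ℕ} (hk : k ≠ 0) {Φ : Circle → Matrix (Fin n) (Fin n) ℂ}
    (hΦ : IsUnitaryAE Φ) : IsUnitaryAE fun z => Φ (z ^ k) :=
  ⟨fun i j => (hΦ.1 i j).comp (continuous_pow k).measurable,
    ae_pow (p := fun z => Φ z ∈ Matrix.unitaryGroup (Fin n) ℂ) hk hΦ.2⟩

theorem IsUnitaryAE.spread_mul {n k : ℕ} (hk : k ≠ 0) {Φ : Circle → Matrix (Fin n) (Fin n) ℂ}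
    (hΦ : IsUnitaryAE Φ) (j : ℕ) (f : L2 n) :
    spread n hk j (hΦ.mul f) = (hΦ.comp_pow hk).mul (spread n hk j f) := by
  rw [spread_apply, spread_apply, IsUnitaryAE.mul_zmul]
  congr 1
  refine Lp.ext ?_
  filter_upwards [coeFn_powSubst hk (hΦ.mul f), ae_pow hk (hΦ.coeFn_mul f),
    (hΦ.comp_pow hk).coeFn_mul (powSubst n hk f), coeFn_powSubst hk f] with z h1 h2 h3 h4
  rw [h1, h2, h3, h4]

/-! ### Wandering subspaces -/

/-- The wandering subspace `V ⊖ S V`. -/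
def wandering {n : ℕ} (V : Submodule ℂ (L2 n)) : Submodule ℂ (L2 n) := V ⊓ (V.map (shift n))ᗮ

theorem inner_zmul_eq_zero_of_mem_wandering {n : ℕ} {V : Submodule ℂ (L2 n)}
    (hV : IsShiftInvariant V) {f g : L2 n} (hf : f ∈ V) (hg : g ∈ wandering V) {m : ℤ}
    (hm : 0 < m) : ⟪zmul n m f, g⟫_ℂ = 0 := by
  refine hg.2 _ ⟨zmul n (m - 1 : ℤ) f, ?_, ?_⟩
  · obtain ⟨l, hl⟩ := Int.eq_ofNat_of_zero_le (show 0 ≤ m - 1 by omega)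
    rw [hl]
    exact hV.zmul_mem l hf
  · rw [shift_eq_zmul, zmul_zmul, add_sub_cancel]

theorem integrable_inner {n : ℕ} (f g : L2 n) : Integrable (fun z => ⟪f z, g z⟫_ℂ) arc :=
  L2.integrable_inner f g

theorem integral_zpow_smul_inner {n : ℕ} (m : ℤ) (f g : L2 n) :
    ∫ z : Circle, (z : ℂ) ^ m • ⟪f z, g z⟫_ℂ ∂arc = ⟪f, zmul n m g⟫_ℂ := by
  rw [L2.inner_def]
  refine integral_congr_ae ?_
  filter_upwards [coeFn_zmul m g] with z h
  rw [h, inner_smul_right, smul_eq_mul]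

/-- Functions in a wandering subspace have a.e. constant pointwise inner products. -/
theorem ae_inner_eq_of_mem_wandering {n : ℕ} {V : Submodule ℂ (L2 n)} (hV : IsShiftInvariant V)
    {f g : L2 n} (hf : f ∈ wandering V) (hg : g ∈ wandering V) :
    ∀ᵐ z ∂arc, ⟪f z, g z⟫_ℂ = ⟪f, g⟫_ℂ := by
  have h0 := ae_eq_zero_of_integral_zpow_smul_eq_zero
    (h := fun z => ⟪f z, g z⟫_ℂ - ⟪f, g⟫_ℂ) ((integrable_inner f g).sub (integrable_const _)) ?_
  · exact h0.mono fun z hz => sub_eq_zero.mp hz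
  intro m
  have hi : Integrable (fun z : Circle => (z : ℂ) ^ m) arc := by
    have hc : Continuous fun z : Circle => (z : ℂ) ^ m :=
      continuous_coe_circle.zpow₀ m fun z => Or.inl z.coe_ne_zero
    exact hc.integrable_of_hasCompactSupport (HasCompactSupport.of_compactSpace _)
  have hi' : Integrable (fun z : Circle => (z : ℂ) ^ m • ⟪f z, g z⟫_ℂ) arc := by
    refine (integrable_inner f (zmul n m g)).congr ?_
    filter_upwards [coeFn_zmul m g] with z h
    rw [h, inner_smul_right, smul_eq_mul]
  simp_rw [smul_sub]
  rw [integral_sub hi' (hi.smul_const _), integral_zpow_smul_inner, integral_smul_const]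
  -- For `m < 0` the power moves to the left factor and `g ⟂ λ⁻ᵐ f`; for `m > 0` the roles of `f`
  -- and `g` are exchanged.
  rcases lt_trichotomy m 0 with hm | rfl | hm
  · rw [integral_zpow hm.ne, inner_zmul_right,
      inner_zmul_eq_zero_of_mem_wandering hV hf.1 hg (by omega), zero_smul, sub_zero]
  · simp [zmul_zero]
  · rw [integral_zpow hm.ne', ← inner_conj_symm,
      inner_zmul_eq_zero_of_mem_wandering hV hg.1 hf hm, map_zero, zero_smul, sub_zero]

theorem ae_orthonormal_of_mem_wandering {n : ℕ} {V : Submodule ℂ (L2 n)}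
    (hV : IsShiftInvariant V) {ι : Type*} [Finite ι] {b : ι → L2 n} (hb : Orthonormal ℂ b)
    (hbV : ∀ i, b i ∈ wandering V) : ∀ᵐ z ∂arc, Orthonormal ℂ fun i => b i z := by
  classical
  have h : ∀ᵐ z ∂arc, ∀ i j, ⟪b i z, b j z⟫_ℂ = ⟪b i, b j⟫_ℂ := by
    rw [ae_all_iff]
    intro i
    rw [ae_all_iff]
    intro j
    exact ae_inner_eq_of_mem_wandering hV (hbV i) (hbV j)
  filter_upwards [h] with z hz
  rw [orthonormal_iff_ite] at hb ⊢
  intro i j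
  rw [hz, hb]

/-- Orthonormalize the span of a finite independent set; at some point `z` the values form an
orthonormal family of the same size in `ℂⁿ`. The cardinal-valued rank is used because finite
dimensionality is itself a consequence. -/
theorem rank_wandering_le {n : ℕ} {V : Submodule ℂ (L2 n)} (hV : IsShiftInvariant V) :
    Module.rank ℂ (wandering V) ≤ n := by
  refine rank_le fun s hs => ?_
  let f : s → L2 n := fun i => ((i : wandering V) : L2 n)
  have hf : LinearIndependent ℂ f :=
    hs.map' (wandering V).subtype (Submodule.ker_subtype _)
  let E := Submodule.span ℂ (Set.range f)
  have hE : E ≤ wandering V := by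
    rw [Submodule.span_le]
    rintro _ ⟨i, rfl⟩
    exact (i : wandering V).2
  have hcard : Module.finrank ℂ E = s.card := by
    rw [finrank_span_eq_card hf, Fintype.card_coe]
  have : FiniteDimensional ℂ E := FiniteDimensional.span_of_finite ℂ (Set.finite_range f)
  let b := stdOrthonormalBasis ℂ E
  have hb : Orthonormal ℂ fun i => (b i : L2 n) := b.orthonormal.comp_linearIsometry E.subtypeₗᵢ
  obtain ⟨z, hz⟩ := (ae_orthonormal_of_mem_wandering hV hb fun i => hE (b i).2).exists
  have := hz.linearIndependent.fintype_card_le_finrank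
  rw [Fintype.card_fin, hcard] at this
  simpa using this

theorem finite_wandering {n : ℕ} {V : Submodule ℂ (L2 n)} (hV : IsShiftInvariant V) :
    FiniteDimensional ℂ (wandering V) :=
  Module.rank_lt_aleph0_iff.mp ((rank_wandering_le hV).trans_lt (Cardinal.natCast_lt_aleph0))

theorem finrank_wandering_le {n : ℕ} {V : Submodule ℂ (L2 n)} (hV : IsShiftInvariant V) :
    Module.finrank ℂ (wandering V) ≤ n :=
  Module.finrank_le_of_rank_le (rank_wandering_le hV)

/-- The matrix-valued function with columns `b j`. -/
def ofColumns {n : ℕ} (b : Fin n → L2 n) (z : Circle) : Matrix (Fin n) (Fin n) ℂ :=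
  Matrix.of fun i j => b j z i

theorem ofColumns_apply {n : ℕ} (b : Fin n → L2 n) (z : Circle) (i j : Fin n) :
    ofColumns b z i j = b j z i := rfl

theorem isUnitaryAE_ofColumns {n : ℕ} {b : Fin n → L2 n}
    (hb : ∀ᵐ z ∂arc, Orthonormal ℂ fun i => b i z) : IsUnitaryAE (ofColumns b) := by
  constructor
  · intro i j
    simp only [ofColumns_apply]
    have h := (Lp.stronglyMeasurable (b j)).measurable
    fun_prop
  · filter_upwards [hb] with z hz
    rw [Matrix.mem_unitaryGroup_iff']
    ext i j
    rw [orthonormal_iff_ite] at hz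
    rw [Matrix.one_apply, ← hz i j, Matrix.mul_apply, PiLp.inner_apply]
    refine Finset.sum_congr rfl fun l _ => ?_
    rw [Matrix.star_apply, ofColumns_apply, ofColumns_apply, RCLike.inner_apply, mul_comm,
      starRingEnd_apply]

theorem ofColumns_mul_cst {n : ℕ} {b : Fin n → L2 n} (h : IsUnitaryAE (ofColumns b)) (c : Cn n) :
    h.mul (cst c) = ∑ i, c i • b i := by
  refine Lp.ext ?_
  have h1 : ∀ᵐ z ∂arc, ∀ i, (c i • b i : L2 n) z = c i • b i z := by
    rw [ae_all_iff]
    intro i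
    exact Lp.coeFn_smul (c i) (b i)
  filter_upwards [h.coeFn_mul (cst c), coeFn_cst c, h1,
    Lp.coeFn_fun_finsetSum Finset.univ fun i => c i • b i] with z h2 h3 h4 h5
  rw [h2, h3, h5]
  simp only [h4]
  ext i
  rw [Matrix.ofLp_toEuclideanCLM]
  simp [Matrix.mulVec, dotProduct, ofColumns_apply, mul_comm]

theorem exists_orthonormal_of_finrank_wandering {n : ℕ} {V : Submodule ℂ (L2 n)}
    (hV : IsShiftInvariant V) (hn : Module.finrank ℂ (wandering V) = n) :
    ∃ b : Fin n → L2 n, Orthonormal ℂ b ∧ ∀ i, b i ∈ wandering V := by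
  have := finite_wandering hV
  let b := (stdOrthonormalBasis ℂ (wandering V)).reindex (finCongr hn)
  exact ⟨fun i => b i, b.orthonormal.comp_linearIsometry (wandering V).subtypeₗᵢ,
    fun i => (b i).2⟩

/-- The preimage of `g` is `Ψ*g`. Its coefficients of index `m < 0` vanish because `Ψc` is
orthogonal to `λ⁻ᵐ V`, so no Wold decomposition is needed. -/
theorem mem_map_mul_hardy {n : ℕ} {V : Submodule ℂ (L2 n)}
    (hV : IsShiftInvariant V) {Ψ : Circle → Matrix (Fin n) (Fin n) ℂ} (hΨ : IsUnitaryAE Ψ)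
    (hcst : ∀ c, hΨ.mul (cst c) ∈ wandering V) {g : L2 n} (hg : g ∈ V) :
    g ∈ (hardy n).map hΨ.mul.toLinearMap := by
  refine Submodule.mem_map.mpr ⟨hΨ.conjTranspose.mul g, ?_, hΨ.mul_conjTranspose_mul g⟩
  rw [mem_hardy]
  intro m hm
  rw [coeff_eq_zero_iff]
  intro c
  rw [← hΨ.mul.inner_map_map, hΨ.mul_conjTranspose_mul, hΨ.mul_zmul, ← inner_conj_symm,
    inner_zmul_right, inner_zmul_eq_zero_of_mem_wandering hV hg (hcst c) (by omega), map_zero]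

theorem map_mul_hardy_le {n : ℕ} {V : Submodule ℂ (L2 n)}
    (hV : IsShiftInvariant V) {Ψ : Circle → Matrix (Fin n) (Fin n) ℂ} (hΨ : IsUnitaryAE Ψ)
    (hcst : ∀ c, hΨ.mul (cst c) ∈ V) : (hardy n).map hΨ.mul.toLinearMap ≤ V := by
  rw [Submodule.map_le_iff_le_comap]
  refine hardy_le_of_zmul_cst_mem (hV.1.preimage hΨ.mul.continuous) fun m c => ?_
  rw [Submodule.mem_comap, LinearIsometry.coe_toLinearMap, hΨ.mul_zmul]
  exact hV.zmul_mem m (hcst c)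

/-- A closed shift-invariant subspace with wandering subspace of full dimension is `Ψ H₊` with `Ψ`
unitary-valued. -/
theorem exists_unitary_of_finrank_wandering {n : ℕ} {V : Submodule ℂ (L2 n)}
    (hV : IsShiftInvariant V) (hn : Module.finrank ℂ (wandering V) = n) :
    ∃ Ψ, IsUnitaryAE Ψ ∧ V = mulMat Ψ (hardy n) := by
  obtain ⟨b, hb, hbV⟩ := exists_orthonormal_of_finrank_wandering hV hn
  have hΨ := isUnitaryAE_ofColumns (ae_orthonormal_of_mem_wandering hV hb hbV)
  have hcst : ∀ c, hΨ.mul (cst c) ∈ wandering V := fun c => by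
    rw [ofColumns_mul_cst]
    exact Submodule.sum_mem _ fun i _ => Submodule.smul_mem _ _ (hbV i)
  refine ⟨ofColumns b, hΨ, ?_⟩
  rw [hΨ.mulMat_eq_map]
  exact le_antisymm (fun g hg => mem_map_mul_hardy hV hΨ hcst hg)
    (map_mul_hardy_le hV hΨ fun c => (hcst c).1)

/-! ### Dimension count -/

/-- The subspace `W ⊖ λᵏ W`. -/
def wanderingPow {n : ℕ} (k : ℕ) (W : Submodule ℂ (L2 n)) : Submodule ℂ (L2 n) :=
  W ⊓ (W.map (zmul n k).toLinearMap)ᗮ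

theorem mem_wanderingPow {n k : ℕ} {W : Submodule ℂ (L2 n)} {f : L2 n} :
    f ∈ wanderingPow k W ↔ f ∈ W ∧ ∀ w ∈ W, ⟪zmul n k w, f⟫_ℂ = 0 := by
  rw [wanderingPow, Submodule.mem_inf, Submodule.mem_orthogonal]
  refine and_congr_right fun _ => ⟨fun h w hw => h _ ⟨w, hw, rfl⟩, ?_⟩
  rintro h _ ⟨w, hw, rfl⟩
  exact h w hw

/-- Rotation by `ω` commutes with `λᵏ` and maps `W` onto itself, its inverse being rotation by
`ω^(k-1)`. -/
theorem isSymmetric_wanderingPow {n k : ℕ} (hk : k ≠ 0) {ω : Circle} (hω : ω ^ k = 1)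
    {W : Submodule ℂ (L2 n)} (hW : IsSymmetric ω W) : IsSymmetric ω (wanderingPow k W) := by
  intro f hf
  rw [mem_wanderingPow] at hf ⊢
  refine ⟨hW f hf.1, fun w hw => ?_⟩
  have hw' : w = rot n ω (rot n (ω ^ (k - 1)) w) := by
    rw [rot_rot, ← pow_succ', Nat.sub_add_cancel (Nat.pos_of_ne_zero hk), hω, rot_one]
  have hz : ∀ g, zmul n k (rot n ω g) = rot n ω (zmul n k g) := fun g => by
    rw [rot_zmul, zpow_natCast, ← Circle.coe_pow, hω, Circle.coe_one, one_smul]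
  rw [hw', hz, LinearIsometry.inner_map_map]
  exact hf.2 _ (rot_pow_mem hW hw _)

/-- `spread` turns the shift into multiplication by `λᵏ`, so orthogonality to `λᵏW` pulls back to
orthogonality to `SV_j`. -/
theorem eigen_wanderingPow_le {n k : ℕ} (hk : k ≠ 0) {ω : Circle} (hω : IsPrimitiveRoot ω k)
    (W : Submodule ℂ (L2 n)) (j : ℕ) :
    eigen ω (wanderingPow k W) j ≤
      (wandering (component hk W j)).map (spread n hk j).toLinearMap := by
  intro f hf
  obtain ⟨hfX, hf⟩ := mem_eigen.mp hf
  rw [mem_wanderingPow] at hfX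
  obtain ⟨g, rfl⟩ := exists_spread_eq hk hω hf
  refine Submodule.mem_map.mpr ⟨g, Submodule.mem_inf.mpr ⟨hfX.1, ?_⟩, rfl⟩
  rw [Submodule.mem_orthogonal]
  rintro _ ⟨v, hv, rfl⟩
  rw [← (spread n hk j).inner_map_map, shift_eq_zmul, spread_zmul, mul_one]
  exact hfX.2 _ hv

/-- The map `(g_j) ↦ ∑ⱼ λʲ g_j(λᵏ)` on the wandering subspaces of the components. -/
def wanderingSum {n k : ℕ} (hk : k ≠ 0) (W : Submodule ℂ (L2 n)) :
    ((j : Fin k) → wandering (component hk W j)) →ₗ[ℂ] L2 n :=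
  ∑ j : Fin k, (spread n hk j).toLinearMap ∘ₗ (wandering (component hk W j)).subtype ∘ₗ
    LinearMap.proj j

theorem wanderingPow_le_range {n k : ℕ} (hk : k ≠ 0) {ω : Circle} (hω : IsPrimitiveRoot ω k)
    {W : Submodule ℂ (L2 n)} (hW : IsSymmetric ω W) :
    wanderingPow k W ≤ LinearMap.range (wanderingSum hk W) := by
  rw [eq_iSup_eigen hk hω (isSymmetric_wanderingPow hk hω.pow_eq_one hW)]
  refine iSup_le fun j => (eigen_wanderingPow_le hk hω W j).trans ?_
  rintro _ ⟨g, hg, rfl⟩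
  refine ⟨Pi.single j ⟨g, hg⟩, ?_⟩
  rw [wanderingSum, LinearMap.sum_apply, Finset.sum_eq_single j]
  · simp
  · intro i _ hij
    simp [Pi.single_eq_of_ne hij]
  · simp

theorem orthonormal_mul_zmul_cst {n : ℕ} {Φ : Circle → Matrix (Fin n) (Fin n) ℂ}
    (hΦ : IsUnitaryAE Φ) (k : ℕ) : Orthonormal ℂ fun p : Fin k × Fin n =>
      hΦ.mul (zmul n (p.1 : ℕ) (cst (EuclideanSpace.single p.2 (1 : ℂ)))) := by
  rw [orthonormal_iff_ite]
  rintro ⟨a, i⟩ ⟨b, j⟩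
  rw [LinearIsometry.inner_map_map, inner_cst_zmul, coeff_zmul, coeff_cst]
  by_cases hab : a = b
  · subst hab
    simp [EuclideanSpace.inner_single_left]
  · have : ((a : ℕ) : ℤ) - ((b : ℕ) : ℤ) ≠ 0 := by
      rw [sub_ne_zero]
      exact fun h => hab (Fin.ext (by exact_mod_cast h))
    simp [hab, this]

theorem mul_zmul_cst_mem_wanderingPow {n : ℕ} {Φ : Circle → Matrix (Fin n) (Fin n) ℂ}
    (hΦ : IsUnitaryAE Φ) {k m : ℕ} (hm : m < k) (c : Cn n) :
    hΦ.mul (zmul n m (cst c)) ∈ wanderingPow k ((hardy n).map hΦ.mul.toLinearMap) := by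
  rw [mem_wanderingPow]
  refine ⟨Submodule.mem_map_of_mem (zmul_mem_hardy (by omega) (cst_mem_hardy c)), ?_⟩
  intro w hw
  obtain ⟨h, hh, rfl⟩ := Submodule.mem_map.mp hw
  rw [LinearIsometry.coe_toLinearMap, ← hΦ.mul_zmul, LinearIsometry.inner_map_map,
    ← inner_conj_symm, inner_cst_zmul, coeff_zmul, mem_hardy.mp hh _ (by omega),
    inner_zero_right, map_zero]

theorem finrank_wandering_component {n k : ℕ} (hk : k ≠ 0) {ω : Circle}
    (hω : IsPrimitiveRoot ω k) {W : Submodule ℂ (L2 n)} (hW : IsShiftInvariant W)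
    (hsym : IsSymmetric ω W) {Φ : Circle → Matrix (Fin n) (Fin n) ℂ} (hΦ : IsUnitaryAE Φ)
    (hWΦ : W = (hardy n).map hΦ.mul.toLinearMap) {j : ℕ} (hj : j < k) :
    Module.finrank ℂ (wandering (component hk W j)) = n := by
  have hV := isShiftInvariant_component hk hW
  have hfin := fun i : Fin k => finite_wandering (hV i)
  have hle := fun i : Fin k => finrank_wandering_le (hV i)
  have hspan : Submodule.span ℂ (Set.range fun p : Fin k × Fin n =>
      hΦ.mul (zmul n (p.1 : ℕ) (cst (EuclideanSpace.single p.2 (1 : ℂ))))) ≤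
      LinearMap.range (wanderingSum hk W) := by
    rw [Submodule.span_le]
    rintro _ ⟨p, rfl⟩
    refine wanderingPow_le_range hk hω hsym ?_
    rw [hWΦ]
    exact mul_zmul_cst_mem_wanderingPow hΦ p.1.2 _
  have h1 := Submodule.finrank_mono hspan
  rw [finrank_span_eq_card (orthonormal_mul_zmul_cst hΦ k).linearIndependent,
    Fintype.card_prod, Fintype.card_fin, Fintype.card_fin] at h1
  have h2 := h1.trans (LinearMap.finrank_range_le (wanderingSum hk W))
  rw [Module.finrank_pi_fintype] at h2
  -- The sum of `k` dimensions, each at most `n`, is at least `kn`, so every one of them equals `n`.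
  have h3 : ∑ i : Fin k, Module.finrank ℂ (wandering (component hk W i)) = ∑ _i : Fin k, n :=
    le_antisymm (Finset.sum_le_sum fun i _ => hle i) (by simpa using h2)
  exact (Finset.sum_eq_sum_iff_of_le fun i _ => hle i).mp h3 ⟨j, hj⟩ (Finset.mem_univ _)

/-! ### The Hardy space under the substitutions -/

theorem isClosed_hardy (n : ℕ) : IsClosed (hardy n : Set (L2 n)) := by
  have : (hardy n : Set (L2 n)) =
      ⋂ (m : ℤ) (_ : m < 0) (c : Cn n), {f | ⟪zmul n m (cst c), f⟫_ℂ = 0} := by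
    ext f
    simp only [SetLike.mem_coe, mem_hardy, coeff_eq_zero_iff, Set.mem_iInter, Set.mem_ofPred_eq]
  rw [this]
  exact isClosed_iInter fun m => isClosed_iInter fun _ => isClosed_iInter fun c =>
    isClosed_eq (continuous_const.inner continuous_id) continuous_const

theorem rot_cst {n : ℕ} (w : Circle) (c : Cn n) : rot n w (cst c) = cst c := by
  refine Lp.ext ?_
  filter_upwards [coeFn_rot w (cst c), ae_mul_left w (coeFn_cst c), coeFn_cst c] with z h1 h2 h3
  rw [h1, h2, h3]

theorem isSymmetric_hardy (n : ℕ) (w : Circle) : IsSymmetric w (hardy n) := by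
  intro f hf m hm
  rw [coeff_eq_zero_iff]
  intro c
  have : zmul n m (cst c) = rot n w (rot n w⁻¹ (zmul n m (cst c))) := by
    rw [rot_rot, mul_inv_cancel, rot_one]
  rw [this, LinearIsometry.inner_map_map, rot_zmul, rot_cst, inner_smul_left,
    (coeff_eq_zero_iff m f).mp (hf m hm), mul_zero]

theorem spread_zmul_cst {n k : ℕ} (hk : k ≠ 0) (j : ℕ) (m : ℤ) (c : Cn n) :
    spread n hk j (zmul n m (cst c)) = zmul n (k * m + j) (cst c) := by
  rw [spread_zmul, spread_apply, powSubst_cst, zmul_zmul]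

theorem spread_mem_hardy {n k : ℕ} (hk : k ≠ 0) (j : ℕ) {f : L2 n} (hf : f ∈ hardy n) :
    spread n hk j f ∈ hardy n := by
  have h : hardy n ≤ component hk (hardy n) j := by
    refine hardy_le_of_zmul_cst_mem
      ((isClosed_hardy n).preimage (spread n hk j).continuous) fun m c => ?_
    rw [mem_component, spread_zmul_cst]
    exact zmul_mem_hardy (by positivity) (cst_mem_hardy c)
  exact h hf

theorem component_hardy_le {n k : ℕ} (hk : k ≠ 0) {j : ℕ} (hj : j < k) :
    component hk (hardy n) j ≤ hardy n := by
  intro f hf m hm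
  rw [coeff_eq_zero_iff]
  intro c
  rw [← (spread n hk j).inner_map_map, spread_zmul_cst]
  refine (coeff_eq_zero_iff _ _).mp (mem_component.mp hf _ ?_) c
  -- With `m ≤ -1` and `j < k`, the index `km + j` is still negative.
  have : (k : ℤ) * m ≤ k * (-1) := mul_le_mul_of_nonneg_left (by omega) (by omega)
  omega

/-- `H₊` is itself rotation-symmetric, so the eigenspace decomposition sorts its Fourier exponents
by residue modulo `k`. -/
theorem hardy_le_iSup_spread {n k : ℕ} (hk : k ≠ 0) {ω : Circle} (hω : IsPrimitiveRoot ω k) :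
    hardy n ≤ ⨆ j : Fin k, (hardy n).map (spread n hk j).toLinearMap := by
  conv_lhs => rw [eq_iSup_eigen hk hω (isSymmetric_hardy n ω)]
  refine iSup_mono fun j => ?_
  rw [eigen_eq_map_spread hk hω]
  exact Submodule.map_mono (component_hardy_le hk j.2)

theorem mem_map_shift_pow {n : ℕ} {U : Submodule ℂ (L2 n)} {j : ℕ} {g : L2 n} :
    g ∈ U.map (shift n ^ j) ↔ ∃ f ∈ U, zmul n j f = g := by
  simp only [Submodule.mem_map, shift_pow_eq_zmul]

theorem mem_map_shift {n : ℕ} {U : Submodule ℂ (L2 n)} {g : L2 n} :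
    g ∈ U.map (shift n) ↔ ∃ f ∈ U, zmul n 1 f = g := by
  simp only [Submodule.mem_map, shift_eq_zmul]

theorem mem_consts {n : ℕ} {α : Submodule ℂ (Cn n)} {g : L2 n} :
    g ∈ consts α ↔ ∃ c ∈ α, cst c = g := Iff.rfl

theorem mem_consts_sup {n : ℕ} {α : Submodule ℂ (Cn n)} {g : L2 n} :
    g ∈ consts α ⊔ (hardy n).map (shift n) ↔
      ∃ c ∈ α, ∃ h ∈ hardy n, cst c + zmul n 1 h = g := by
  rw [Submodule.mem_sup]
  constructor
  · rintro ⟨a, ha, b, hb, rfl⟩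
    obtain ⟨c, hc, rfl⟩ := mem_consts.mp ha
    obtain ⟨h, hh, rfl⟩ := mem_map_shift.mp hb
    exact ⟨c, hc, h, hh, rfl⟩
  · rintro ⟨c, hc, h, hh, rfl⟩
    exact ⟨_, mem_consts.mpr ⟨c, hc, rfl⟩, _, mem_map_shift.mpr ⟨h, hh, rfl⟩, rfl⟩

/-- For `j < k - 1` the constants in `U j` give `λʲα_j`, and the rest gives exponents at least `k`,
absorbed by `λᵏ⁻¹H₊`. Conversely `λᵏ⁻¹H₊` splits by residues into the pieces `λᵏ⁻¹⁺ⁱ h(λᵏ)`. -/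
theorem iSup_map_spread_eq {n k : ℕ} (hk : k ≠ 0) {ω : Circle} (hω : IsPrimitiveRoot ω k)
    {α : ℕ → Submodule ℂ (Cn n)} {U : ℕ → Submodule ℂ (L2 n)}
    (hU : ∀ j < k - 1, U j = consts (α j) ⊔ (hardy n).map (shift n)) (hU' : U (k - 1) = hardy n) :
    ⨆ j : Fin k, (U j).map (spread n hk j).toLinearMap =
      (⨆ j : Fin (k - 1), (consts (α j)).map (shift n ^ (j : ℕ))) ⊔
        (hardy n).map (shift n ^ (k - 1)) := by
  apply le_antisymm
  · refine iSup_le fun j => ?_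
    rintro _ ⟨f, hf, rfl⟩
    rw [LinearIsometry.coe_toLinearMap]
    by_cases hj : (j : ℕ) < k - 1
    · rw [hU j hj] at hf
      obtain ⟨c, hc, h, hh, rfl⟩ := mem_consts_sup.mp hf
      rw [map_add]
      refine Submodule.add_mem_sup ?_ ?_
      · refine Submodule.mem_iSup_of_mem (⟨j, hj⟩ : Fin (k - 1)) ?_
        refine mem_map_shift_pow.mpr ⟨cst c, mem_consts.mpr ⟨c, hc, rfl⟩, ?_⟩
        rw [spread_apply, powSubst_cst]
      · refine mem_map_shift_pow.mpr ⟨zmul n 1 (spread n hk j h),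
          zmul_mem_hardy zero_le_one (spread_mem_hardy hk j hh), ?_⟩
        rw [spread_zmul, zmul_zmul]
        congr 2
        push_cast [Nat.one_le_iff_ne_zero.mpr hk]
        ring
    · have hj' : (j : ℕ) = k - 1 := by omega
      rw [hj', hU'] at hf
      refine Submodule.mem_sup_right (mem_map_shift_pow.mpr
        ⟨spread n hk 0 f, spread_mem_hardy hk 0 hf, ?_⟩)
      rw [zmul_spread, hj', add_zero]
  · refine sup_le (iSup_le fun j => ?_) ?_
    · intro g hg
      obtain ⟨_, ⟨c, hc, rfl⟩, rfl⟩ := mem_map_shift_pow.mp hg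
      refine Submodule.mem_iSup_of_mem (⟨j, by omega⟩ : Fin k)
        (Submodule.mem_map.mpr ⟨cst c, ?_, ?_⟩)
      · rw [hU j j.2]
        exact Submodule.mem_sup_left (mem_consts.mpr ⟨c, hc, rfl⟩)
      · rw [LinearIsometry.coe_toLinearMap, spread_apply, powSubst_cst]
    · refine (Submodule.map_mono (hardy_le_iSup_spread hk hω)).trans ?_
      rw [Submodule.map_iSup]
      refine iSup_le fun i => ?_
      intro g hg
      obtain ⟨_, ⟨h, hh, rfl⟩, rfl⟩ := mem_map_shift_pow.mp hg
      rw [LinearIsometry.coe_toLinearMap, zmul_spread]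
      -- For `i = 0` the piece lies in the top component; for `i ≥ 1` the exponent is `k + (i - 1)`,
      -- the shifted part of component `i - 1`.
      by_cases hi : (i : ℕ) = 0
      · refine Submodule.mem_iSup_of_mem (⟨k - 1, by omega⟩ : Fin k)
          (Submodule.mem_map.mpr ⟨h, ?_, ?_⟩)
        · rw [hU']
          exact hh
        · rw [LinearIsometry.coe_toLinearMap, hi, add_zero]
      · refine Submodule.mem_iSup_of_mem (⟨i - 1, by omega⟩ : Fin k)
          (Submodule.mem_map.mpr ⟨zmul n 1 h, ?_, ?_⟩)
        · rw [hU _ (show (i : ℕ) - 1 < k - 1 by omega)]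
          exact Submodule.mem_sup_right (mem_map_shift.mpr ⟨h, hh, rfl⟩)
        · rw [LinearIsometry.coe_toLinearMap, spread_zmul, mul_one, zmul_spread]
          congr 2
          change k + ((i : ℕ) - 1) = k - 1 + i
          omega

/-! ### The loops `π_α + λ π_α^⊥` -/

theorem isIsometryAE_projLoop {n : ℕ} (α : Submodule ℂ (Cn n)) : IsIsometryAE (projLoop α) where
  aestronglyMeasurable :=
    (continuous_const.add (continuous_coe_circle.smul continuous_const)).aestronglyMeasurable
  norm_map := Filter.Eventually.of_forall fun z v => by
    have h0 : ⟪α.starProjection v, (z : ℂ) • αᗮ.starProjection v⟫_ℂ = 0 := by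
      rw [inner_smul_right, Submodule.inner_right_of_mem_orthogonal
        (α.starProjection_apply_mem v) (αᗮ.starProjection_apply_mem v), mul_zero]
    have h1 : ‖projLoop α z v‖ * ‖projLoop α z v‖ = ‖v‖ * ‖v‖ := by
      change ‖α.starProjection v + (z : ℂ) • αᗮ.starProjection v‖ *
        ‖α.starProjection v + (z : ℂ) • αᗮ.starProjection v‖ = _
      rw [norm_add_sq_eq_norm_sq_add_norm_sq_of_inner_eq_zero _ _ h0, norm_smul, Circle.norm_coe,
        one_mul, ← sq, ← sq, ← sq, Submodule.norm_sq_eq_add_norm_sq_starProjection v α]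
    exact (mul_self_inj (norm_nonneg _) (norm_nonneg _)).mp h1

theorem compLp_mem_hardy {n : ℕ} (L : Cn n →L[ℂ] Cn n) {f : L2 n} (hf : f ∈ hardy n) :
    L.compLp f ∈ hardy n := by
  intro m hm
  have : coeff m (L.compLp f) = L (coeff m f) := by
    rw [coeff, coeff, ← L.integral_comp_comm (integrable_zpow_smul (-m) f)]
    refine integral_congr_ae ?_
    filter_upwards [L.coeFn_compLp f] with z hz
    rw [hz, map_smul]
  rw [this, hf m hm, map_zero]

theorem projLoop_mul_eq {n : ℕ} (α : Submodule ℂ (Cn n)) (f : L2 n) :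
    (isIsometryAE_projLoop α).mul f =
      α.starProjection.compLp f + zmul n 1 (αᗮ.starProjection.compLp f) := by
  refine Lp.ext ?_
  filter_upwards [(isIsometryAE_projLoop α).coeFn_mul f, α.starProjection.coeFn_compLp f,
    αᗮ.starProjection.coeFn_compLp f, coeFn_zmul 1 (αᗮ.starProjection.compLp f),
    Lp.coeFn_add (α.starProjection.compLp f) (zmul n 1 (αᗮ.starProjection.compLp f))]
    with z h1 h2 h3 h4 h5
  rw [h1, h5, Pi.add_apply, h2, h4, h3, zpow_one]
  rfl

theorem compLp_cst {n : ℕ} (L : Cn n →L[ℂ] Cn n) (c : Cn n) : L.compLp (cst c) = cst (L c) := by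
  refine Lp.ext ?_
  filter_upwards [L.coeFn_compLp (cst c), coeFn_cst c, coeFn_cst (L c)] with z h1 h2 h3
  rw [h1, h2, h3]

theorem compLp_zmul {n : ℕ} (L : Cn n →L[ℂ] Cn n) (m : ℤ) (f : L2 n) :
    L.compLp (zmul n m f) = zmul n m (L.compLp f) := by
  refine Lp.ext ?_
  filter_upwards [L.coeFn_compLp (zmul n m f), coeFn_zmul m f, coeFn_zmul m (L.compLp f),
    L.coeFn_compLp f] with z h1 h2 h3 h4
  rw [h1, h2, h3, h4, map_smul]

theorem exists_projLoop_mul_eq {n : ℕ} {α : Submodule ℂ (Cn n)} {c : Cn n} (hc : c ∈ α)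
    {h : L2 n} (hh : h ∈ hardy n) :
    ∃ f ∈ hardy n, (isIsometryAE_projLoop α).mul f = cst c + zmul n 1 h := by
  -- The witness is the pointwise inverse `π_α + λ⁻¹π_α^⊥` applied to `c + λh`; as `c ∈ α`, no
  -- negative power remains.
  refine ⟨cst c + (α.starProjection.compLp (zmul n 1 h) + αᗮ.starProjection.compLp h),
    add_mem (cst_mem_hardy c) (add_mem
      (compLp_mem_hardy _ (zmul_mem_hardy zero_le_one hh)) (compLp_mem_hardy _ hh)), ?_⟩
  refine Lp.ext ?_
  filter_upwards [(isIsometryAE_projLoop α).coeFn_mul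
      (cst c + (α.starProjection.compLp (zmul n 1 h) + αᗮ.starProjection.compLp h)),
    α.starProjection.coeFn_compLp (zmul n 1 h), αᗮ.starProjection.coeFn_compLp h,
    coeFn_zmul 1 h, coeFn_cst c, Lp.coeFn_add (cst c) (zmul n 1 h),
    Lp.coeFn_add (cst c) (α.starProjection.compLp (zmul n 1 h) + αᗮ.starProjection.compLp h),
    Lp.coeFn_add (α.starProjection.compLp (zmul n 1 h)) (αᗮ.starProjection.compLp h)]
    with z h1 h2 h3 h4 h5 h6 h7 h8
  rw [h1, h6, h7, Pi.add_apply, Pi.add_apply, h8, Pi.add_apply, h2, h3, h4, h5, zpow_one]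
  have e1 : α.starProjection c = c := Submodule.starProjection_eq_self_iff.mpr hc
  have e2 : ∀ v, αᗮ.starProjection v = v - α.starProjection v := fun v => by
    rw [Submodule.starProjection_orthogonal_val]
  have e3 : ∀ v, α.starProjection (α.starProjection v) = α.starProjection v := fun v =>
    Submodule.starProjection_eq_self_iff.mpr (α.starProjection_apply_mem v)
  simp only [projLoop, add_apply, smul_apply, map_add,
    map_sub, map_smul, e1, e2, e3]
  module

theorem map_projLoop_hardy {n : ℕ} (α : Submodule ℂ (Cn n)) :
    (hardy n).map (isIsometryAE_projLoop α).mul.toLinearMap =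
      consts α ⊔ (hardy n).map (shift n) := by
  ext g
  rw [mem_consts_sup, Submodule.mem_map]
  constructor
  · rintro ⟨f, hf, rfl⟩
    obtain ⟨c, h, hh, rfl⟩ := exists_eq_cst_add_zmul hf
    -- For `f = c + λh`, the image is `π_α c + λ(π_α h + π_α^⊥ f)`.
    refine ⟨α.starProjection c, α.starProjection_apply_mem c,
      α.starProjection.compLp h + αᗮ.starProjection.compLp (cst c + zmul n 1 h),
      add_mem (compLp_mem_hardy _ hh) (compLp_mem_hardy _ hf), ?_⟩
    have hadd : α.starProjection.compLp (cst c + zmul n 1 h) =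
        α.starProjection.compLp (cst c) + α.starProjection.compLp (zmul n 1 h) :=
      map_add (α.starProjection.compLpₗ 2 arc) _ _
    rw [LinearIsometry.coe_toLinearMap, projLoop_mul_eq, hadd, compLp_cst, compLp_zmul, map_add,
      add_assoc]
  · rintro ⟨c, hc, h, hh, rfl⟩
    exact exists_projLoop_mul_eq hc hh

theorem mulOp_comp_projLoop {n : ℕ} {Ψ : Circle → Matrix (Fin n) (Fin n) ℂ}
    (α : Submodule ℂ (Cn n)) :
    mulOp (fun z => Matrix.toEuclideanCLM (𝕜 := ℂ) (Ψ z) ∘L projLoop α z) (hardy n) =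
      mulMat Ψ (consts α ⊔ (hardy n).map (shift n)) := by
  rw [← map_projLoop_hardy]
  ext g
  constructor
  · rintro ⟨f, hf, hg⟩
    refine ⟨_, Submodule.mem_map_of_mem hf, ?_⟩
    filter_upwards [hg, (isIsometryAE_projLoop α).coeFn_mul f] with z h1 h2
    rw [h1, LinearIsometry.coe_toLinearMap, h2]
    rfl
  · rintro ⟨_, ⟨f, hf, rfl⟩, hg⟩
    refine ⟨f, hf, ?_⟩
    filter_upwards [hg, (isIsometryAE_projLoop α).coeFn_mul f] with z h1 h2
    rw [h1, LinearIsometry.coe_toLinearMap, h2]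
    rfl

/-! ### Subspaces between `λ Ψ H₊` and `Ψ H₊` -/

/-- The subspace of all `c ∈ ℂⁿ` with `Ψ c ∈ V`. -/
def constPart {n : ℕ} {Ψ : Circle → Matrix (Fin n) (Fin n) ℂ} (hΨ : IsUnitaryAE Ψ)
    (V : Submodule ℂ (L2 n)) : Submodule ℂ (Cn n) :=
  V.comap (hΨ.mul.toLinearMap ∘ₗ Lp.constₗ 2 arc ℂ)

theorem mem_constPart {n : ℕ} {Ψ : Circle → Matrix (Fin n) (Fin n) ℂ} {hΨ : IsUnitaryAE Ψ}
    {V : Submodule ℂ (L2 n)} {c : Cn n} : c ∈ constPart hΨ V ↔ hΨ.mul (cst c) ∈ V := Iff.rfl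

/-- Since `λΨH₊ ⊆ V`, membership of `Ψ(c + λh)` in `V` depends only on the constant term `c`. -/
theorem eq_map_consts_sup {n : ℕ} {Ψ : Circle → Matrix (Fin n) (Fin n) ℂ} (hΨ : IsUnitaryAE Ψ)
    {V V' : Submodule ℂ (L2 n)} (hV' : V' = (hardy n).map hΨ.mul.toLinearMap) (hle : V ≤ V')
    (hge : V'.map (shift n) ≤ V) :
    V = (consts (constPart hΨ V) ⊔ (hardy n).map (shift n)).map hΨ.mul.toLinearMap := by
  have hz : ∀ h ∈ hardy n, hΨ.mul (zmul n 1 h) ∈ V := fun h hh => by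
    rw [hΨ.mul_zmul]
    refine hge (mem_map_shift.mpr ⟨_, ?_, rfl⟩)
    rw [hV']
    exact Submodule.mem_map_of_mem hh
  ext g
  rw [Submodule.mem_map]
  constructor
  · intro hg
    have hg' := hle hg
    rw [hV'] at hg'
    obtain ⟨f, hf, rfl⟩ := Submodule.mem_map.mp hg'
    refine ⟨f, ?_, rfl⟩
    obtain ⟨c, h, hh, rfl⟩ := exists_eq_cst_add_zmul hf
    refine mem_consts_sup.mpr ⟨c, mem_constPart.mpr ?_, h, hh, rfl⟩
    rw [LinearIsometry.coe_toLinearMap, map_add] at hg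
    exact (V.add_mem_iff_left (hz h hh)).mp hg
  · rintro ⟨f, hf, rfl⟩
    obtain ⟨c, hc, h, hh, rfl⟩ := mem_consts_sup.mp hf
    rw [LinearIsometry.coe_toLinearMap, map_add]
    exact V.add_mem (mem_constPart.mp hc) (hz h hh)

theorem map_spread_map_mul {n k : ℕ} (hk : k ≠ 0) {Ψ : Circle → Matrix (Fin n) (Fin n) ℂ}
    (hΨ : IsUnitaryAE Ψ) (j : ℕ) (U : Submodule ℂ (L2 n)) :
    (U.map hΨ.mul.toLinearMap).map (spread n hk j).toLinearMap =
      (U.map (spread n hk j).toLinearMap).map (hΨ.comp_pow hk).mul.toLinearMap := by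
  rw [← Submodule.map_comp, ← Submodule.map_comp]
  congr 1
  ext1 f
  exact hΨ.spread_mul hk j f

theorem component_mono {n k : ℕ} (hk : k ≠ 0) {W : Submodule ℂ (L2 n)}
    (hW : IsShiftInvariant W) : Monotone (component hk W) :=
  monotone_nat_of_le_succ (component_le_succ hk hW)

end SymShift

end

/-! ### Assembly of the three assertions -/

open SymShift
theorem proposition3p1 (n k : ℕ) (hk : 2 ≤ k) (ω : Circle) (hω : IsPrimitiveRoot ω k)
    (W : Submodule ℂ (L2 n)) (hW : IsShiftInvariant W) (hsym : IsSymmetric ω W) :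
    -- (i) eigenspace decomposition
    ((∀ j < k, IsClosed (eigen ω W j : Set (L2 n)) ∧
        (eigen ω W j : Set (L2 n)) =
          {g | g ∈ W ∧ ∃ f ∈ W,
            g = ∑ l ∈ Finset.range k, ((ω : ℂ) ^ (l * j))⁻¹ • rot n (ω ^ l) f}) ∧
      W = ⨆ j : Fin k, eigen ω W j ∧
      iSupIndep (fun j : Fin k => eigen ω W j) ∧
      Pairwise (fun i j : Fin k => eigen ω W i ⟂ eigen ω W j)) ∧
    -- (ii) the filtration
    ∃ V : ℕ → Submodule ℂ (L2 n),
      ((∀ j < k, IsShiftInvariant (V j)) ∧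
        (V (k - 1)).map (shift n) ≤ V 0 ∧
        (∀ j, j + 1 < k → V j ≤ V (j + 1)) ∧
        (∀ j < k, eigen ω W j =
          ((V j).map (powSubst n (show k ≠ 0 by omega)).toLinearMap).map (shift n ^ j))) ∧
      -- (iii) the case `W = Φ H₊`
      ∀ Φ : Circle → Matrix (Fin n) (Fin n) ℂ, IsUnitaryAE Φ → W = mulMat Φ (hardy n) →
        ∃ (Ψ : Circle → Matrix (Fin n) (Fin n) ℂ) (α : ℕ → Submodule ℂ (Cn n)),
          IsUnitaryAE Ψ ∧
          V (k - 1) = mulMat Ψ (hardy n) ∧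
          (∀ j, j + 1 < k - 1 → α j ≤ α (j + 1)) ∧
          (∀ j < k - 1,
            V j = mulOp (fun z => Matrix.toEuclideanCLM (𝕜 := ℂ) (Ψ z) ∘L projLoop (α j) z)
                (hardy n) ∧
            V j = mulMat Ψ (consts (α j) ⊔ (hardy n).map (shift n))) ∧
          W = mulMat (fun z => Ψ (z ^ k))
            ((⨆ j : Fin (k - 1), (consts (α j)).map (shift n ^ (j : ℕ))) ⊔
              (hardy n).map (shift n ^ (k - 1))) := by
  have hk0 : k ≠ 0 := by omega
  refine ⟨⟨fun j _ => ⟨isClosed_eigen ω hW.1 j, eigen_eq_setOf_average hk0 hω.pow_eq_one j⟩,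
    eq_iSup_eigen hk0 hω hsym, eigen_iSupIndep hω W, eigen_isOrtho hω W⟩, component hk0 W,
    ⟨fun j _ => isShiftInvariant_component hk0 hW j, map_shift_component_le hk0 hW,
      fun j _ => component_le_succ hk0 hW j, fun j _ => ?_⟩, fun Φ hΦ hWΦ => ?_⟩
  · rw [eigen_eq_map_spread hk0 hω, map_spread]
  rw [hΦ.mulMat_eq_map] at hWΦ
  obtain ⟨Ψ, hΨ, hV⟩ := exists_unitary_of_finrank_wandering
    (isShiftInvariant_component hk0 hW (k - 1))
    (finrank_wandering_component hk0 hω hW hsym hΦ hWΦ (show k - 1 < k by omega))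
  have hV' := hV
  rw [hΨ.mulMat_eq_map] at hV'
  -- The sandwich is `SV_{k-1} ⊆ V_0 ⊆ V_j ⊆ V_{k-1} = ΨH₊`.
  have hVj : ∀ j < k - 1, component hk0 W j =
      (consts (constPart hΨ (component hk0 W j)) ⊔
        (hardy n).map (shift n)).map hΨ.mul.toLinearMap := fun j hj =>
    eq_map_consts_sup hΨ hV' (component_mono hk0 hW hj.le)
      ((map_shift_component_le hk0 hW).trans (component_mono hk0 hW (Nat.zero_le j)))
  refine ⟨Ψ, fun j => constPart hΨ (component hk0 W j), hΨ, hV,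
    fun j _ => Submodule.comap_mono (component_le_succ hk0 hW j), fun j hj => ?_, ?_⟩
  · rw [mulOp_comp_projLoop, hΨ.mulMat_eq_map]
    exact ⟨hVj j hj, hVj j hj⟩
  -- `U j` is `V_j` with `Ψ` stripped off; the default branch is the top index, where it is all of
  -- `H₊`.
  · let U : ℕ → Submodule ℂ (L2 n) := fun j => if j < k - 1 then
      consts (constPart hΨ (component hk0 W j)) ⊔ (hardy n).map (shift n) else hardy n
    have hVU : ∀ j : Fin k, component hk0 W j = (U j).map hΨ.mul.toLinearMap := fun j => by
      by_cases hj : (j : ℕ) < k - 1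
      · simp only [U, if_pos hj]
        exact hVj j hj
      · simp only [U, if_neg hj]
        rw [show (j : ℕ) = k - 1 by omega]
        exact hV'
    rw [(hΨ.comp_pow hk0).mulMat_eq_map,
      ← iSup_map_spread_eq hk0 hω (U := U) (fun j hj => if_pos hj) (if_neg (lt_irrefl _)),
      Submodule.map_iSup]
    -- Compare eigenspace by eigenspace: `λʲ(ΨU_j)(λᵏ) = Ψ(λᵏ)·λʲU_j(λᵏ)`.
    conv_lhs => rw [eq_iSup_eigen hk0 hω hsym]
    refine iSup_congr fun j => ?_
    rw [eigen_eq_map_spread hk0 hω, hVU j, map_spread_map_mul]
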